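/- Let $E$ be a real Fréchet space, that is, a complete Hausdorff topological vector space whose topology is defined by a sequence of seminorms $\{\|\cdot\|_n\}_{n\in\mathbb N}$. Let $\{e_k\}_{k\in\mathbb N}$ be an unconditional Schauder basis of $E$: every $x\in E$ has a unique expansion $x=\sum_{k=1}^\infty x_ke_k$, convergent in $E$, and $\sum_{k=1}^\infty x_{\pi(k)}e_{\pi(k)}=x$ for every permutation $\pi$ of $\mathbb N$. Write $x\ll y$ if $x_k\le y_k$ for all $k\in\mathbb N$. A function $g:M\to E$ on a measure space $(M,\mu)$ is called integrable if there are step functions $g_n:M\to E$ (measurable, with finitely many values, nonzero only on a set of finite measure) such that $g_n\to g$ almost everywhere and $\int_M\|g_n-g_m\|_s\,d\mu\to0$ as $n,m\to\infty$ for every $s\in\mathbb N$; then $\int_M g\,d\mu:=\lim_{n\to\infty}\int_M g_n\,d\mu$. Let $T>0$, $I_T=[0,T]$ with Lebesgue measure, $\hat x\in E$, and let $f:I_T\times E\to E$, $f(t,x)=\sum_{k=1}^\infty f_k(t,x)e_k$, be such that: 1. for all $t\in I_T$ and $k\in\mathbb N$ the function $f_k(t,\cdot)$ is left continuous, i.e.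 $f_k(t,u_n)\to f_k(t,u)$ whenever $u_n\to u$ in $E$ and $u_n\ll u_{n+1}$ for all $n$; 2. for every $x\in E$ the function $t\mapsto f(t,x)$ is integrable on $I_T$; 3. there is $C\in E$ with $f(t,x)\ll C$ for all $(t,x)\in I_T\times E$; 4. there is $x_*\in E$ with $x_*\ll\hat x+\int_0^tf(\xi,x_*)\,d\xi$ for all $t\in I_T$; 5. if $x\ll y$ then $f(t,x)\ll f(t,y)$ for all $t\in I_T$. A solution of the problem $\dot x=f(t,x)$, $x(0)=\hat x$ is a continuous function $x:I_T\to E$ such that $t\mapsto f(t,x(t))$ is integrable on $I_T$ and $x(t)=\hat x+\int_0^tf(\xi,x(\xi))\,d\xi$ for all $t\in I_T$. Assume in addition that $E$ is reflexive, i.e. the canonical map of $E$ into its strong bidual is a bijective homeomorphism. Then a solution exists, and every solution $x$ is weakly differentiable almost everywhere with $\dot x(t)=f(t,x(t))$: there is a function $\dot x:I_T\to E$ such that for almost all $t\in I_T$ $$\psi\Big(\frac{x(t+h)-x(t)}{h}\Big)\to\psi(\dot x(t))\quad\text{as }h\to0,\ h\ne0,\quad\text{for all }\psi\in E',$$ and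 $\dot x(t)=f(t,x(t))$. -/

import Mathlib

open Filter Topology MeasureTheory Set

noncomputable section

section Basis

variable {E : Type*} [AddCommGroup E] [Module ℝ E] [TopologicalSpace E]

/-- `x = ∑ₖ c k • e k`, the series (limit of the partial sums in the given order) converging in
the topology of `E`. -/
def IsExpansion (e : ℕ → E) (x : E) (c : ℕ → ℝ) : Prop :=
  Tendsto (fun n => ∑ k ∈ Finset.range n, c k • e k) atTop (𝓝 x)

/-- `e` is an unconditional Schauder basis of `E`: each `x` has exactly one expansion along `e`,
and each rearrangement of that expansion converges to the same element `x`. -/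
structure IsUnconditionalBasis (e : ℕ → E) : Prop where
  existsUnique_expansion : ∀ x : E, ∃! c : ℕ → ℝ, IsExpansion e x c
  rearrangement : ∀ (x : E) (c : ℕ → ℝ), IsExpansion e x c →
    ∀ π : Equiv.Perm ℕ, IsExpansion (fun k => e (π k)) x (fun k => c (π k))

namespace IsUnconditionalBasis

variable {e : ℕ → E}

/-- The `k`-th coordinate of `x`. -/
def coord (he : IsUnconditionalBasis e) (k : ℕ) (x : E) : ℝ :=
  (he.existsUnique_expansion x).choose k

theorem isExpansion_coord (he : IsUnconditionalBasis e) (x : E) :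
    IsExpansion e x (fun k => he.coord k x) :=
  (he.existsUnique_expansion x).choose_spec.1

/-- The coordinatewise partial order on `E`. -/
def CoordLE (he : IsUnconditionalBasis e) (x y : E) : Prop :=
  ∀ k, he.coord k x ≤ he.coord k y

/-- `g` is left continuous: `g (u n) → g x'` along each increasing sequence `u n → x'`. -/
def LeftContinuous (he : IsUnconditionalBasis e) (g : E → ℝ) : Prop :=
  ∀ (x' : E) (u : ℕ → E), Tendsto u atTop (𝓝 x') → (∀ n, he.CoordLE (u n) (u (n + 1))) →
    Tendsto (fun n => g (u n)) atTop (𝓝 (g x'))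

end IsUnconditionalBasis

end Basis

section Integral

variable {E : Type*} [AddCommGroup E] [Module ℝ E] [TopologicalSpace E]
variable {M : Type*} [MeasurableSpace M]

/-- The integral `∑ₐ μ(φ⁻¹{a}) a` of a step function (the value `a = 0` contributes nothing). -/
def stepIntegral (μ : Measure M) (φ : SimpleFunc M E) : E :=
  ∑ a ∈ φ.range, μ.real (φ ⁻¹' {a}) • a

/-- `φ` is an approximating sequence for `g`: the `φ n` are step functions (measurable, with
finitely many values) vanishing off a set of finite measure, they form a Cauchy sequence for each
of the seminorms `φ ↦ ∫ p s (φ x) dμ`, and `φ n → g` almost everywhere. -/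
structure IsApproximating (p : SeminormFamily ℝ E ℕ) (μ : Measure M)
    (g : M → E) (φ : ℕ → SimpleFunc M E) : Prop where
  finite_support : ∀ n, μ {x | φ n x ≠ 0} < ⊤
  cauchy : ∀ (s : ℕ) (ε : ℝ), 0 < ε → ∃ l : ℕ, ∀ i m : ℕ, l < i → l < m →
    ∫⁻ x, ENNReal.ofReal (p s (φ i x - φ m x)) ∂μ < ENNReal.ofReal ε
  ae_tendsto : ∀ᵐ x ∂μ, Tendsto (fun n => φ n x) atTop (𝓝 (g x))

/-- Integrability of a function with values in a Fréchet space whose topology is given by the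
seminorms `p`. -/
def FrechetIntegrable (p : SeminormFamily ℝ E ℕ) (μ : Measure M) (g : M → E) : Prop :=
  ∃ φ : ℕ → SimpleFunc M E, IsApproximating p μ g φ

/-- `v` is the limit of the integrals of some approximating sequence for `g`.
In a Fréchet space each integrable `g` has exactly one such `v`. -/
def HasFrechetIntegral (p : SeminormFamily ℝ E ℕ) (μ : Measure M) (g : M → E) (v : E) : Prop :=
  ∃ φ : ℕ → SimpleFunc M E, IsApproximating p μ g φ ∧
    Tendsto (fun n => stepIntegral μ (φ n)) atTop (𝓝 v)

open Classical in
/-- The integral of `g`, the value `v` with `HasFrechetIntegral p μ g v`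
(and `0` if there is none). -/
def frechetIntegral (p : SeminormFamily ℝ E ℕ) (μ : Measure M) (g : M → E) : E :=
  if h : ∃ v, HasFrechetIntegral p μ g v then h.choose else 0

end Integral

section Reflexive

variable (E : Type*) [AddCommGroup E] [Module ℝ E] [TopologicalSpace E]

/-- The canonical map `x ↦ (ψ ↦ ψ x)` of `E` into its bidual. Both `StrongDual`s carry the strong
topology, that of uniform convergence on bounded sets. -/
def bidualMap [ContinuousSMul ℝ E] (x : E) : StrongDual ℝ (StrongDual ℝ E) where
  toFun ψ := ψ x
  map_add' _ _ := rfl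
  map_smul' _ _ := rfl
  cont := continuous_eval_const x

/-- `E` is reflexive: the canonical map of `E` into its strong bidual is bijective and a
homeomorphism. -/
def IsReflexiveSpace [ContinuousSMul ℝ E] : Prop := IsHomeomorph (bidualMap E)

end Reflexive

section Problem

variable {E : Type*} [AddCommGroup E] [Module ℝ E] [TopologicalSpace E]

/-- `x` is a solution on `[0, T]` of `ẋ = f(t, x)`, `x(0) = x₀`: it is continuous on `[0, T]`,
`t ↦ f(t, x(t))` is integrable there, and `x(t) = x₀ + ∫₀ᵗ f(ξ, x(ξ)) dξ`. -/
structure IsSolution (p : SeminormFamily ℝ E ℕ) (T : ℝ) (f : ℝ → E → E) (x₀ : E)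
    (x : ℝ → E) : Prop where
  continuousOn : ContinuousOn x (Icc 0 T)
  integrable : FrechetIntegrable p (volume.restrict (Icc 0 T)) (fun t => f t (x t))
  integral_eq : ∀ t ∈ Icc 0 T,
    x t = x₀ + frechetIntegral p (volume.restrict (Icc 0 t)) (fun ξ => f ξ (x ξ))

/-- `v` is the weak derivative of `x` at `t`. -/
def HasWeakDerivAt (x : ℝ → E) (v : E) (t : ℝ) : Prop :=
  ∀ ψ : StrongDual ℝ E, Tendsto (fun h : ℝ => ψ (h⁻¹ • (x (t + h) - x t))) (𝓝[≠] 0) (𝓝 (ψ v))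

end Problem

end

/-! Existence is a monotone Picard iteration. Iterate `x ↦ x₀ + ∫₀ᵗ f(ξ, x(ξ)) dξ` from the constant
`xs`. The lower-solution hypothesis gives the first inequality, monotonicity of `f` propagates it,
and the bound `C` keeps every iterate below `x₀ + t • C`; so each coordinate increases to a limit.
Two facts about unconditional bases make this a limit in `E`: a coordinate sequence squeezed between
those of two elements belongs to an element (`exists_coord_eq_of_le`, after translation), and
coordinatewise convergence inside an order interval is convergence (`tendsto_of_coord`). Both hold
because tails are uniformly small over an order interval, which follows from unconditional
summability (`exists_forall_proj_lt`) and convexity. Left continuity and scalar dominated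
convergence then identify the limit as a fixed point.

Integrals are computed coordinate by coordinate, so the coordinates must be continuous. This is
derived from Baire's theorem by successive approximation, as in the open mapping theorem
(`le_two_of_mem_closure_ball`); the result is that the suprema of seminorms over finite subsums are
continuous. They also dominate order intervals, so a measurable curve between two integrable ones is
integrable. Measurability of `t ↦ f(t, x(t))` comes from approximating `x` from below by countably
valued curves, the direction in which left continuity applies.

For differentiability, an integrable `g` has almost all its values in a separable set. Lebesgue's
scalar theorem for `p s (g - d)`, with `d` in a countable dense set, makes the difference quotients
of the primitive converge almost everywhere in the topology of `E` (`ae_tendsto_slope_primitive`),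
hence weakly. -/

noncomputable section

set_option linter.unusedSectionVars false

/-! ### Permutations of `ℕ` assembled from finite blocks -/

section Permutations

/-- A finite subset `G` of `[a, b)` is the image of an initial segment of `[a, b)` under a
permutation of `ℕ` supported in `[a, b)`. -/
theorem exists_perm_image_Ico (a b : ℕ) (G : Finset ℕ) (hG : G ⊆ Finset.Ico a b) :
    ∃ σ : Equiv.Perm ℕ, (∀ n, n ∈ Finset.Ico a b ↔ σ n ∈ Finset.Ico a b) ∧
      (Finset.Ico a (a + G.card)).map σ.toEmbedding = G := by
  classical
  have hcard : a + G.card ≤ max a b := by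
    have := Finset.card_le_card hG
    rw [Nat.card_Ico] at this
    omega
  set S := {n // n ∈ Finset.Ico a b}
  have hc : Fintype.card {n : S // (n : ℕ) < a + G.card} = Fintype.card {n : S // (n : ℕ) ∈ G} := by
    have h1 : Fintype.card {n : S // (n : ℕ) ∈ G} = G.card := by
      rw [← Fintype.card_coe]
      exact Fintype.card_congr
        ⟨fun n => ⟨n.1, n.2⟩, fun n => ⟨⟨n.1, hG n.2⟩, n.2⟩, fun _ => rfl, fun _ => rfl⟩
    have h2 : Fintype.card {n : S // (n : ℕ) < a + G.card} = (Finset.Ico a (a + G.card)).card := by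
      rw [← Fintype.card_coe (Finset.Ico a (a + G.card))]
      refine Fintype.card_congr
        ⟨fun n => ⟨n.1, ?_⟩, fun n => ⟨⟨n.1, ?_⟩, ?_⟩, fun _ => rfl, fun _ => rfl⟩
      · exact Finset.mem_Ico.2 ⟨(Finset.mem_Ico.1 n.1.2).1, n.2⟩
      · have := Finset.mem_Ico.1 n.2
        exact Finset.mem_Ico.2 ⟨this.1, by omega⟩
      · exact (Finset.mem_Ico.1 n.2).2
    rw [h1, h2]; simp
  -- Two subsets of `S` of equal size: a bijection between them extends to a permutation of the
  -- finite type `S`, and then by the identity to `ℕ`.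
  let τ : Equiv.Perm S := (Fintype.equivOfCardEq hc).extendSubtype
  have hτ : ∀ n : S, (n : ℕ) < a + G.card → (τ n : ℕ) ∈ G := fun n hn => by
    have := (Fintype.equivOfCardEq hc).extendSubtype_mem n hn
    exact this
  refine ⟨Equiv.Perm.ofSubtype τ, fun n => ?_, ?_⟩
  · exact (Equiv.Perm.ofSubtype_apply_mem_iff_mem τ n).symm
  · refine Finset.eq_of_subset_of_card_le ?_ (by simp)
    intro m hm
    simp only [Finset.mem_map, Equiv.coe_toEmbedding] at hm
    obtain ⟨n, hn, rfl⟩ := hm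
    have hn1 := Finset.mem_Ico.1 hn
    have hn' : n ∈ Finset.Ico a b := Finset.mem_Ico.2 ⟨hn1.1, by omega⟩
    have h := hτ ⟨n, hn'⟩ hn1.2
    rwa [Equiv.Perm.ofSubtype_apply_of_mem τ hn']

/-- Permutations of the blocks `[a i, a (i + 1))` can be glued together. -/
theorem exists_perm_of_blocks (a : ℕ → ℕ) (ha : StrictMono a) (ha0 : a 0 = 0)
    (σ : ℕ → Equiv.Perm ℕ)
    (hσ : ∀ i n, n ∈ Finset.Ico (a i) (a (i + 1)) ↔ σ i n ∈ Finset.Ico (a i) (a (i + 1))) :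
    ∃ π : Equiv.Perm ℕ, ∀ i, ∀ n ∈ Finset.Ico (a i) (a (i + 1)), π n = σ i n := by
  have hex : ∀ n, ∃ i, n ∈ Finset.Ico (a i) (a (i + 1)) := by
    intro n
    induction n with
    | zero => exact ⟨0, by have := ha Nat.zero_lt_one; simp; omega⟩
    | succ n ih =>
      obtain ⟨i, hi⟩ := ih
      by_cases h : n + 1 < a (i + 1)
      · exact ⟨i, by simp at *; omega⟩
      · exact ⟨i + 1, by have := ha (Nat.lt_succ_self (i + 1)); simp at *; omega⟩
  have huniq : ∀ n i j, n ∈ Finset.Ico (a i) (a (i + 1)) → n ∈ Finset.Ico (a j) (a (j + 1)) →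
      i = j := by
    intro n i j hi hj
    simp only [Finset.mem_Ico] at hi hj
    have h1 := ha.lt_iff_lt.1 (hi.1.trans_lt hj.2)
    have h2 := ha.lt_iff_lt.1 (hj.1.trans_lt hi.2)
    omega
  choose blk hblk using hex
  refine ⟨Equiv.ofBijective (fun n => σ (blk n) n) ⟨?_, ?_⟩, ?_⟩
  · intro n m hnm
    replace hnm : σ (blk n) n = σ (blk m) m := hnm
    have h : blk n = blk m := huniq _ _ _ ((hσ _ _).1 (hblk n)) (hnm ▸ (hσ _ _).1 (hblk m))
    rw [h] at hnm
    exact (σ _).injective hnm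
  · intro m
    have hm : (σ (blk m)).symm m ∈ Finset.Ico (a (blk m)) (a (blk m + 1)) := by
      rw [hσ]; simpa using hblk m
    refine ⟨(σ (blk m)).symm m, ?_⟩
    change σ (blk ((σ (blk m)).symm m)) ((σ (blk m)).symm m) = m
    rw [huniq _ _ _ (hblk _) hm, Equiv.apply_symm_apply]
  · intro i n hn
    change σ (blk n) n = σ i n
    rw [huniq _ _ _ (hblk n) hn]

end Permutations

/-! ### Weighted sums as convex combinations of subset sums -/

section ConvexHull

/-- A seminorm of a combination with weights in `[0, 1]` is at most its largest value at a
subset sum. -/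
theorem Seminorm.sum_smul_le_of_subset_sum_le {E : Type*} [AddCommGroup E] [Module ℝ E]
    (q : Seminorm ℝ E) (F : Finset ℕ) (z : ℕ → E) (w : ℕ → ℝ) (hw : ∀ k ∈ F, w k ∈ Icc (0 : ℝ) 1)
    (r : ℝ) (hr : ∀ G ⊆ F, q (∑ k ∈ G, z k) ≤ r) : q (∑ k ∈ F, w k • z k) ≤ r := by
  classical
  -- The base point `v` is generalised so that the induction can use both choices for a new index:
  -- leave `z a` out, or absorb it into `v`.
  suffices h : ∀ F : Finset ℕ, (∀ k ∈ F, w k ∈ Icc (0 : ℝ) 1) → ∀ v : E,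
      (∀ G ⊆ F, q (v + ∑ k ∈ G, z k) ≤ r) → q (v + ∑ k ∈ F, w k • z k) ≤ r by
    simpa using h F hw 0 (by simpa using hr)
  intro F
  induction F using Finset.induction_on with
  | empty => intro _ v h; simpa using h ∅
  | insert a s has ih =>
    intro hw v h
    have hwa := hw a (Finset.mem_insert_self a s)
    have hws : ∀ k ∈ s, w k ∈ Icc (0 : ℝ) 1 := fun k hk => hw k (Finset.mem_insert_of_mem hk)
    have h1 := ih hws v fun G hG => h G (hG.trans (Finset.subset_insert a s))
    have h2 := ih hws (v + z a) fun G hG => by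
      have := h (insert a G) (Finset.insert_subset_insert a hG)
      rwa [Finset.sum_insert (fun h => has (hG h)), ← add_assoc] at this
    have key : v + ∑ k ∈ insert a s, w k • z k = (1 - w a) • (v + ∑ k ∈ s, w k • z k) +
        w a • (v + z a + ∑ k ∈ s, w k • z k) := by
      rw [Finset.sum_insert has]; module
    rw [key]
    refine (map_add_le_add q _ _).trans ?_
    rw [map_smul_eq_mul, map_smul_eq_mul, Real.norm_of_nonneg (by linarith [hwa.2]),
      Real.norm_of_nonneg hwa.1]
    nlinarith [mul_le_mul_of_nonneg_left h1 (by linarith [hwa.2] : 0 ≤ 1 - w a),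
      mul_le_mul_of_nonneg_left h2 hwa.1]

end ConvexHull

/-! ### Linearity of the coordinates -/

namespace IsUnconditionalBasis

section Algebra

variable {E : Type*} [AddCommGroup E] [Module ℝ E] [TopologicalSpace E]
  {e : ℕ → E} (he : IsUnconditionalBasis e)

theorem coord_eq {x : E} {c : ℕ → ℝ} (h : IsExpansion e x c) (k : ℕ) : he.coord k x = c k :=
  congrFun ((he.existsUnique_expansion x).unique (he.isExpansion_coord x) h) k

/-- Otherwise the zero vector would have a second expansion, with coefficient `1` at `k`. -/
theorem ne_zero [T1Space E] (he : IsUnconditionalBasis e) (k : ℕ) : e k ≠ 0 := by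
  classical
  intro hk
  have h0 : IsExpansion e 0 (0 : ℕ → ℝ) := by simp [IsExpansion]
  have h1 : IsExpansion e 0 (Pi.single k 1) := by
    have : ∀ n, ∑ j ∈ Finset.range n, (Pi.single k (1 : ℝ) : ℕ → ℝ) j • e j = 0 := by
      intro n
      refine Finset.sum_eq_zero fun j _ => ?_
      by_cases h : j = k
      · subst h; simp [hk]
      · simp [h]
    simp only [IsExpansion, this]
    exact tendsto_const_nhds
  have h2 := (he.coord_eq h0 k).symm.trans (he.coord_eq h1 k)
  simp at h2

theorem ext_coord [T2Space E] {x y : E} (h : ∀ k, he.coord k x = he.coord k y) : x = y := by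
  have h1 := he.isExpansion_coord x
  simp only [h] at h1
  exact tendsto_nhds_unique h1 (he.isExpansion_coord y)

theorem coord_add [ContinuousAdd E] (k : ℕ) (x y : E) :
    he.coord k (x + y) = he.coord k x + he.coord k y := by
  refine he.coord_eq (c := fun k => he.coord k x + he.coord k y) ?_ k
  have := (he.isExpansion_coord x).add (he.isExpansion_coord y)
  simpa only [IsExpansion, add_smul, Finset.sum_add_distrib] using this

theorem coord_smul [ContinuousConstSMul ℝ E] (k : ℕ) (r : ℝ) (x : E) :
    he.coord k (r • x) = r * he.coord k x := by
  refine he.coord_eq (c := fun k => r * he.coord k x) ?_ k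
  have := (he.isExpansion_coord x).const_smul r
  simpa only [IsExpansion, mul_smul, Finset.smul_sum] using this

variable [ContinuousAdd E] [ContinuousConstSMul ℝ E]

/-- The coordinate as a linear map. -/
def coordₗ (k : ℕ) : E →ₗ[ℝ] ℝ where
  toFun := he.coord k
  map_add' := he.coord_add k
  map_smul' := he.coord_smul k

@[simp] theorem coordₗ_apply (k : ℕ) (x : E) : he.coordₗ k x = he.coord k x := rfl

theorem coord_sub (k : ℕ) (x y : E) : he.coord k (x - y) = he.coord k x - he.coord k y :=
  map_sub (he.coordₗ k) x y

/-- The projection to the span of `e k`, `k ∈ F`. -/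
def proj (F : Finset ℕ) : E →ₗ[ℝ] E := ∑ k ∈ F, (he.coordₗ k).smulRight (e k)

theorem proj_apply (F : Finset ℕ) (x : E) : he.proj F x = ∑ k ∈ F, he.coord k x • e k := by
  simp [proj]

theorem tendsto_proj_range (x : E) :
    Tendsto (fun n => he.proj (Finset.range n) x) atTop (𝓝 x) := by
  simpa only [proj_apply, IsExpansion] using he.isExpansion_coord x

end Algebra

end IsUnconditionalBasis

/-! ### Unconditional summability and seminorms of finite subsums -/

namespace IsUnconditionalBasis

variable {E : Type*} [AddCommGroup E] [Module ℝ E] [UniformSpace E] [IsUniformAddGroup E]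
  [ContinuousSMul ℝ E] {e : ℕ → E} (he : IsUnconditionalBasis e)

theorem proj_union (F G : Finset ℕ) (h : Disjoint F G) (x : E) :
    he.proj (F ∪ G) x = he.proj F x + he.proj G x := by
  simp only [proj_apply]; exact Finset.sum_union h

/-- The expansion of `x` is unconditionally Cauchy. -/
theorem exists_forall_proj_lt (q : Seminorm ℝ E) (hq : Continuous q) (x : E) {ε : ℝ}
    (hε : 0 < ε) : ∃ N : ℕ, ∀ G : Finset ℕ, (∀ k ∈ G, N ≤ k) → q (he.proj G x) < ε := by
  by_contra! hcon
  choose G hG hGε using hcon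
  -- Block endpoints: the next one lies beyond every index of the bad set `G (a i)`, so the chosen
  -- bad sets sit in disjoint blocks.
  let a : ℕ → ℕ := fun i => Nat.rec 0 (fun _ n => max (n + 1) ((G n).sup id + 1)) i
  have ha0 : a 0 = 0 := rfl
  have hasucc : ∀ i, a (i + 1) = max (a i + 1) ((G (a i)).sup id + 1) := fun i => rfl
  have ha : StrictMono a := strictMono_nat_of_lt_succ fun i => by rw [hasucc]; omega
  have hsub : ∀ i, G (a i) ⊆ Finset.Ico (a i) (a (i + 1)) := by
    intro i k hk
    have h1 : k ≤ (G (a i)).sup id := Finset.le_sup (f := id) hk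
    refine Finset.mem_Ico.2 ⟨hG _ k hk, ?_⟩
    rw [hasucc]; omega
  choose σ hσ hσG using fun i => exists_perm_image_Ico (a i) (a (i + 1)) (G (a i)) (hsub i)
  obtain ⟨π, hπ⟩ := exists_perm_of_blocks a ha ha0 σ hσ
  -- `π` moves each bad set to the front of its block. A difference of two partial sums of the
  -- rearranged series is then a bad subsum, of size at least `ε`, although the series converges.
  have hexp := he.rearrangement x _ (he.isExpansion_coord x) π
  have hat : Tendsto a atTop atTop := ha.tendsto_atTop
  have hbt : Tendsto (fun i => a i + (G (a i)).card) atTop atTop :=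
    tendsto_atTop_mono (fun i => Nat.le_add_right _ _) hat
  have hdiff := (hexp.comp hbt).sub (hexp.comp hat)
  rw [sub_self] at hdiff
  have hq0 := (hq.tendsto 0).comp hdiff
  rw [map_zero] at hq0
  obtain ⟨i, hi⟩ := (hq0.eventually (gt_mem_nhds hε)).exists
  refine absurd hi (not_lt.2 ((hGε (a i)).trans (le_of_eq ?_)))
  simp only [Function.comp_apply]
  congr 1
  rw [← Finset.sum_Ico_eq_sub _ (Nat.le_add_right _ _), proj_apply]
  have hcard : a i + (G (a i)).card ≤ a (i + 1) := by
    have h1 := Finset.card_le_card (hsub i)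
    have h2 : a i < a (i + 1) := ha (Nat.lt_succ_self i)
    rw [Nat.card_Ico] at h1
    omega
  conv_lhs => rw [← hσG i, Finset.sum_map]
  refine Finset.sum_congr rfl fun n hn => ?_
  have hn1 := Finset.mem_Ico.1 hn
  rw [hπ i n (Finset.mem_Ico.2 ⟨hn1.1, by omega⟩)]
  rfl

/-- Indices below a suitable `N` contribute at most a fixed finite sum, and those beyond it at most
`1`. -/
theorem bddAbove_proj (q : Seminorm ℝ E) (hq : Continuous q) (x : E) :
    BddAbove (range fun F : Finset ℕ => q (he.proj F x)) := by
  classical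
  obtain ⟨N, hN⟩ := he.exists_forall_proj_lt q hq x one_pos
  refine ⟨∑ k ∈ Finset.range N, q (he.coord k x • e k) + 1, ?_⟩
  rintro _ ⟨F, rfl⟩
  have h1 : he.proj F x = he.proj (F.filter (· < N)) x + he.proj (F.filter (¬ · < N)) x := by
    rw [← he.proj_union _ _ (Finset.disjoint_filter_filter_not _ _ _),
      Finset.filter_union_filter_not_eq]
  simp only [h1]
  refine (map_add_le_add q _ _).trans (add_le_add ?_ (hN _ fun k hk => ?_).le)
  · rw [proj_apply]
    refine (Finset.le_sum_of_subadditive q (map_zero q).le (map_add_le_add q) _ _).trans ?_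
    refine Finset.sum_le_sum_of_subset_of_nonneg (fun k hk => ?_) fun _ _ _ => apply_nonneg _ _
    simp at hk; simp [hk.2]
  · simp at hk; omega

/-- The supremum of `q` over all the finite subsums of the expansion. -/
def supSeminorm (q : Seminorm ℝ E) : Seminorm ℝ E := ⨆ F : Finset ℕ, q.comp (he.proj F)

theorem supSeminorm_apply (q : Seminorm ℝ E) (hq : Continuous q) (x : E) :
    he.supSeminorm q x = ⨆ F : Finset ℕ, q (he.proj F x) := by
  rw [supSeminorm, Seminorm.iSup_apply]
  · rfl
  · rw [Seminorm.bddAbove_range_iff]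
    exact fun x => he.bddAbove_proj q hq x

theorem proj_le_supSeminorm (q : Seminorm ℝ E) (hq : Continuous q) (F : Finset ℕ) (x : E) :
    q (he.proj F x) ≤ he.supSeminorm q x := by
  rw [he.supSeminorm_apply q hq]
  exact le_ciSup (he.bddAbove_proj q hq x) F

theorem supSeminorm_le (q : Seminorm ℝ E) (hq : Continuous q) (x : E) {r : ℝ}
    (h : ∀ F, q (he.proj F x) ≤ r) : he.supSeminorm q x ≤ r := by
  rw [he.supSeminorm_apply q hq]
  exact ciSup_le h

theorem le_supSeminorm (q : Seminorm ℝ E) (hq : Continuous q) (x : E) :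
    q x ≤ he.supSeminorm q x :=
  le_of_tendsto ((hq.tendsto x).comp (he.tendsto_proj_range x))
    (Eventually.of_forall fun _ => he.proj_le_supSeminorm q hq _ x)

theorem abs_coord_mul_le (q : Seminorm ℝ E) (hq : Continuous q) (k : ℕ) (x : E) :
    |he.coord k x| * q (e k) ≤ he.supSeminorm q x := by
  have := he.proj_le_supSeminorm q hq {k} x
  rwa [proj_apply, Finset.sum_singleton, map_smul_eq_mul, Real.norm_eq_abs] at this

/-- If the coordinates of `u` lie between `0` and those of `y`, then each seminorm of a finite
subsum of `u` is at most the corresponding one of some smaller subsum of `y`. -/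
theorem sum_smul_le_of_proj_le (q : Seminorm ℝ E) {y : E} {c : ℕ → ℝ}
    (h0 : ∀ k, 0 ≤ c k) (hc : ∀ k, c k ≤ he.coord k y) (F : Finset ℕ) (r : ℝ)
    (hr : ∀ G ⊆ F, q (he.proj G y) ≤ r) : q (∑ k ∈ F, c k • e k) ≤ r := by
  -- The ratios are weights in `[0, 1]`; where the coordinate of `y` vanishes so does `c k`, and
  -- division by zero does no harm.
  have key : ∀ k, c k • e k = (c k / he.coord k y) • (he.coord k y • e k) := by
    intro k
    by_cases hk : he.coord k y = 0
    · have : c k = 0 := le_antisymm (hk ▸ hc k) (h0 k)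
      simp [this]
    · rw [smul_smul, div_mul_cancel₀ _ hk]
  simp only [key]
  refine Seminorm.sum_smul_le_of_subset_sum_le q F _ _ (fun k _ => ⟨?_, ?_⟩) r fun G hG => ?_
  · exact div_nonneg (h0 k) ((h0 k).trans (hc k))
  · exact div_le_one_of_le₀ (hc k) ((h0 k).trans (hc k))
  · simpa only [proj_apply] using hr G hG

theorem seminorm_le_supSeminorm_of_le (q : Seminorm ℝ E) (hq : Continuous q) {u y : E}
    (h0 : ∀ k, 0 ≤ he.coord k u) (h : ∀ k, he.coord k u ≤ he.coord k y) :
    q u ≤ he.supSeminorm q y := by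
  refine le_of_tendsto ((hq.tendsto u).comp (he.isExpansion_coord u))
    (Eventually.of_forall fun n => ?_)
  exact he.sum_smul_le_of_proj_le q h0 h _ _ fun G _ => he.proj_le_supSeminorm q hq G y

variable {p : SeminormFamily ℝ E ℕ}

/-- If `y` converges to `x`, and is Cauchy for the seminorms `supSeminorm (p s)`, then the
coordinates of `y` converge to those of `x`. -/
theorem tendsto_coord_of_cauchy [T2Space E] (hp : WithSeminorms p) (y : ℕ → E) (x : E)
    (hy : Tendsto y atTop (𝓝 x))
    (hc : ∀ s, ∀ ε > 0, ∃ N, ∀ i ≥ N, ∀ j ≥ N, he.supSeminorm (p s) (y i - y j) ≤ ε) (k : ℕ) :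
    Tendsto (fun i => he.coord k (y i)) atTop (𝓝 (he.coord k x)) := by
  have hps := hp.continuous_seminorm
  have hcau : ∀ k, CauchySeq fun i => he.coord k (y i) := by
    intro k
    obtain ⟨s, hs⟩ := hp.separating_of_T1 (e k) (he.ne_zero k)
    have hs' : 0 < p s (e k) := lt_of_le_of_ne (apply_nonneg _ _) (Ne.symm hs)
    rw [Metric.cauchySeq_iff]
    intro ε hε
    obtain ⟨N, hN⟩ := hc s (ε / 2 * p s (e k)) (by positivity)
    refine ⟨N, fun i hi j hj => ?_⟩
    have h1 := (he.abs_coord_mul_le (p s) (hps s) k (y i - y j)).trans (hN i hi j hj)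
    have h2 := le_of_mul_le_mul_right h1 hs'
    rw [he.coord_sub] at h2
    rw [Real.dist_eq]; linarith
  choose c hcl using fun k => cauchySeq_tendsto_of_complete (hcau k)
  -- Continuity of the coordinates is not available here. Instead the limits `c` are shown to expand
  -- `x`, by interchanging two limits with uniform control, and uniqueness of the expansion
  -- concludes.
  suffices h : IsExpansion e x c by rw [he.coord_eq h]; exact hcl k
  rw [IsExpansion, hp.tendsto_nhds_atTop]
  intro s ε hε
  obtain ⟨N, hN⟩ := hc s (ε / 4) (by positivity)
  have hlim : ∀ n, p s (∑ k ∈ Finset.range n, c k • e k - he.proj (Finset.range n) (y N)) ≤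
      ε / 4 := by
    intro n
    have ht : Tendsto (fun i => he.proj (Finset.range n) (y i)) atTop
        (𝓝 (∑ k ∈ Finset.range n, c k • e k)) := by
      simp only [proj_apply]
      exact tendsto_finsetSum _ fun k _ => (hcl k).smul_const _
    refine le_of_tendsto (((hps s).tendsto _).comp (ht.sub_const _)) ?_
    filter_upwards [eventually_ge_atTop N] with i hi
    simp only [Function.comp_apply, ← map_sub]
    exact (he.proj_le_supSeminorm _ (hps s) _ _).trans (hN i hi N le_rfl)
  have hxN : p s (y N - x) ≤ ε / 4 := by
    refine le_of_tendsto (((hps s).tendsto _).comp (hy.const_sub (y N))) ?_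
    filter_upwards [eventually_ge_atTop N] with i hi
    exact (he.le_supSeminorm _ (hps s) _).trans (hN N le_rfl i hi)
  have h3 := (hp.tendsto_nhds_atTop _ _).1 (he.tendsto_proj_range (y N)) s (ε / 4) (by positivity)
  obtain ⟨n₀, hn₀⟩ := h3
  refine ⟨n₀, fun n hn => ?_⟩
  have key : ∑ k ∈ Finset.range n, c k • e k - x =
      (∑ k ∈ Finset.range n, c k • e k - he.proj (Finset.range n) (y N)) +
      (he.proj (Finset.range n) (y N) - y N) + (y N - x) := by abel
  rw [key]
  have h4 := map_add_le_add (p s)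
    ((∑ k ∈ Finset.range n, c k • e k - he.proj (Finset.range n) (y N)) +
      (he.proj (Finset.range n) (y N) - y N)) (y N - x)
  have h5 := map_add_le_add (p s)
    (∑ k ∈ Finset.range n, c k • e k - he.proj (Finset.range n) (y N))
      (he.proj (Finset.range n) (y N) - y N)
  have h6 := hlim n
  have h7 := hn₀ n hn
  linarith

/-- Coordinatewise convergence in an order interval `[a, b]` implies convergence. -/
theorem tendsto_of_coord (hp : WithSeminorms p) {a b : E} {u : ℕ → E} {v : E}
    (ha : ∀ n, he.CoordLE a (u n)) (hb : ∀ n, he.CoordLE (u n) b)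
    (h : ∀ k, Tendsto (fun n => he.coord k (u n)) atTop (𝓝 (he.coord k v))) :
    Tendsto u atTop (𝓝 v) := by
  have hps := hp.continuous_seminorm
  have hva : he.CoordLE a v := fun k => ge_of_tendsto (h k) (Eventually.of_forall fun n => ha n k)
  have hvb : he.CoordLE v b := fun k => le_of_tendsto (h k) (Eventually.of_forall fun n => hb n k)
  rw [hp.tendsto_nhds]
  intro s ε hε
  obtain ⟨N, hN⟩ := he.exists_forall_proj_lt (p s) (hps s) (b - a) (ε := ε / 4) (by positivity)
  -- Every `w - a` with `w` in the interval is dominated by `b - a`, so one `N` bounds all the tails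
  -- at once.
  have htail : ∀ w, he.CoordLE a w → he.CoordLE w b →
      p s (w - a - he.proj (Finset.range N) (w - a)) ≤ ε / 4 := by
    intro w hwa hwb
    have hlim := (((he.tendsto_proj_range (w - a)).sub_const (he.proj (Finset.range N) (w - a))))
    refine le_of_tendsto (((hps s).tendsto _).comp hlim) ?_
    filter_upwards [eventually_ge_atTop N] with n hn
    simp only [Function.comp_apply, proj_apply]
    rw [← Finset.sum_Ico_eq_sub _ hn]
    refine he.sum_smul_le_of_proj_le (p s) (y := b - a) (fun k => ?_) (fun k => ?_) _ _
      fun G hG => (hN G fun k hk => (Finset.mem_Ico.1 (hG hk)).1).le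
    · rw [he.coord_sub]; linarith [hwa k]
    · rw [he.coord_sub, he.coord_sub]; linarith [hwb k]
  have hfin : Tendsto (fun n => he.proj (Finset.range N) (u n - v)) atTop (𝓝 0) := by
    have : Tendsto (fun n => ∑ k ∈ Finset.range N, (he.coord k (u n) - he.coord k v) • e k) atTop
        (𝓝 (∑ k ∈ Finset.range N, (he.coord k v - he.coord k v) • e k)) :=
      tendsto_finsetSum _ fun k _ => ((h k).sub_const _).smul_const _
    simpa only [proj_apply, he.coord_sub, sub_self, zero_smul, Finset.sum_const_zero] using this
  have hfin' := ((hps s).tendsto 0).comp hfin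
  rw [map_zero] at hfin'
  filter_upwards [hfin'.eventually (gt_mem_nhds (by positivity : 0 < ε / 4))] with n hn
  simp only [Function.comp_apply] at hn
  have key : u n - v = (u n - a - he.proj (Finset.range N) (u n - a)) -
      (v - a - he.proj (Finset.range N) (v - a)) + he.proj (Finset.range N) (u n - v) := by
    simp only [map_sub]; abel
  have h1 := htail (u n) (ha n) (hb n)
  have h2 := htail v hva hvb
  rw [key]
  have h3 := map_add_le_add (p s) ((u n - a - he.proj (Finset.range N) (u n - a)) -
      (v - a - he.proj (Finset.range N) (v - a))) (he.proj (Finset.range N) (u n - v))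
  have h4 := map_sub_le_add (p s) (u n - a - he.proj (Finset.range N) (u n - a))
      (v - a - he.proj (Finset.range N) (v - a))
  linarith

end IsUnconditionalBasis

/-! ### Baire category and continuity of the coordinates -/

/-- In a Baire topological vector space, the closures of the balls of any seminorm are
neighbourhoods of `0`. -/
theorem Seminorm.closure_ball_mem_nhds {E : Type*} [AddCommGroup E] [Module ℝ E]
    [TopologicalSpace E] [IsTopologicalAddGroup E] [ContinuousSMul ℝ E] [BaireSpace E]
    (q : Seminorm ℝ E) {r : ℝ} (hr : 0 < r) : closure (q.ball 0 r) ∈ 𝓝 (0 : E) := by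
  have hU : ⋃ n : ℕ, closure (q.ball 0 (n + 1)) = univ := by
    refine eq_univ_of_forall fun x => mem_iUnion.2 ?_
    obtain ⟨n, hn⟩ := exists_nat_gt (q x)
    exact ⟨n, subset_closure (by rw [Seminorm.mem_ball_zero]; linarith)⟩
  obtain ⟨n, x, hx⟩ := nonempty_interior_of_iUnion_of_closed (fun _ => isClosed_closure) hU
  -- Both `x + c • w` and `x` lie in the closed ball-closure of radius `n + 1`; the constant `c`
  -- scales their difference, of size below `2 * (n + 1)`, to below `r`.
  rw [mem_interior_iff_mem_nhds] at hx
  set c : ℝ := 2 * (n + 1) / r with hc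
  have hc0 : 0 < c := by positivity
  have ht : Tendsto (fun w : E => x + c • w) (𝓝 0) (𝓝 x) := by
    have : Continuous fun w : E => x + c • w := by fun_prop
    simpa using this.tendsto 0
  filter_upwards [ht hx] with w hw
  have hcont : Continuous fun z : E × E => c⁻¹ • (z.1 - z.2) := by fun_prop
  have := map_mem_closure₂ (f := fun a b : E => c⁻¹ • (a - b)) (u := q.ball 0 r) hcont hw
    (mem_of_mem_nhds hx) ?_
  · simpa [smul_smul, inv_mul_cancel₀ hc0.ne'] using this
  · intro a ha b hb
    rw [Seminorm.mem_ball_zero] at *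
    rw [map_smul_eq_mul, Real.norm_of_nonneg (by positivity), hc, inv_div, div_mul_eq_mul_div,
      div_lt_iff₀ (by positivity)]
    have := map_sub_le_add q a b
    nlinarith

theorem WithSeminorms.isCountablyGenerated_uniformity {E : Type*} [AddCommGroup E] [Module ℝ E]
    [UniformSpace E] [IsUniformAddGroup E] {p : SeminormFamily ℝ E ℕ} (hp : WithSeminorms p) :
    (uniformity E).IsCountablyGenerated :=
  have := hp.firstCountableTopology
  IsUniformAddGroup.uniformity_countably_generated

theorem WithSeminorms.baireSpace {E : Type*} [AddCommGroup E] [Module ℝ E]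
    [UniformSpace E] [IsUniformAddGroup E] [CompleteSpace E] {p : SeminormFamily ℝ E ℕ}
    (hp : WithSeminorms p) : BaireSpace E :=
  have := hp.isCountablyGenerated_uniformity
  inferInstance

/-- A sequence whose distance for each of the defining seminorms is controlled is convergent. -/
theorem WithSeminorms.exists_tendsto_of_cauchy {E : Type*} [AddCommGroup E] [Module ℝ E]
    [UniformSpace E] [IsUniformAddGroup E] [CompleteSpace E] {p : SeminormFamily ℝ E ℕ}
    (hp : WithSeminorms p) (y : ℕ → E)
    (hy : ∀ s, ∀ ε > 0, ∃ N, ∀ i ≥ N, ∀ j ≥ N, p s (y i - y j) < ε) :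
    ∃ x, Tendsto y atTop (𝓝 x) := by
  refine cauchySeq_tendsto_of_complete ?_
  rw [CauchySeq, cauchy_map_iff', uniformity_eq_comap_nhds_zero, tendsto_comap_iff,
    hp.tendsto_nhds]
  intro s ε hε
  obtain ⟨N, hN⟩ := hy s ε hε
  rw [prod_atTop_atTop_eq]
  filter_upwards [eventually_ge_atTop (N, N)] with i hi
  simpa using hN i.2 hi.2 i.1 hi.1

namespace IsUnconditionalBasis

variable {E : Type*} [AddCommGroup E] [Module ℝ E] [UniformSpace E] [IsUniformAddGroup E]
  [ContinuousSMul ℝ E] [CompleteSpace E] {e : ℕ → E} (he : IsUnconditionalBasis e)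
  {p : SeminormFamily ℝ E ℕ}

/-- Each sequence between `0` and the coordinates of some `y` is the coordinate sequence of some
element of the space. -/
theorem exists_coord_eq_of_le (hp : WithSeminorms p) {y : E} {c : ℕ → ℝ} (h0 : ∀ k, 0 ≤ c k)
    (hc : ∀ k, c k ≤ he.coord k y) : ∃ u, ∀ k, he.coord k u = c k := by
  have hps := hp.continuous_seminorm
  obtain ⟨u, hu⟩ := hp.exists_tendsto_of_cauchy (fun n => ∑ k ∈ Finset.range n, c k • e k) (by
    intro s ε hε
    obtain ⟨N, hN⟩ := he.exists_forall_proj_lt (p s) (hps s) y (half_pos hε)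
    have hle : ∀ i j, i ≤ j → N ≤ i →
        p s (∑ k ∈ Finset.range j, c k • e k - ∑ k ∈ Finset.range i, c k • e k) < ε := by
      intro i j hij hi
      rw [← Finset.sum_Ico_eq_sub _ hij]
      refine (he.sum_smul_le_of_proj_le (p s) h0 hc _ (ε / 2) fun G hG => ?_).trans_lt
        (half_lt_self hε)
      refine (hN G fun k hk => ?_).le
      have := Finset.mem_Ico.1 (hG hk)
      omega
    refine ⟨N, fun i hi j hj => ?_⟩
    rcases le_total i j with hij | hij
    · rw [map_sub_rev]; exact hle i j hij hi
    · exact hle j i hij hj)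
  exact ⟨u, fun k => he.coord_eq hu k⟩

variable [T2Space E]

/-- Successive approximation removes the closure at the cost of a factor `2`: `x` is a series of
vectors `g j (z j)` whose sup-seminorms are at most `2⁻ʲ`. Convergence is only known in the original
topology, so the bound is passed to `x` through the coordinates. -/
theorem le_two_of_mem_closure_ball (hp : WithSeminorms p) (m : ℕ) (x : E)
    (hx : x ∈ closure (((Finset.range m).sup fun s => he.supSeminorm (p s)).ball 0 1)) (s : ℕ)
    (hs : s < m) : he.supSeminorm (p s) x ≤ 2 := by
  have hps := hp.continuous_seminorm
  have := hp.baireSpace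
  set R : ℕ → Seminorm ℝ E := fun m => (Finset.range m).sup fun s => he.supSeminorm (p s) with hR
  have hRs : ∀ m s, s < m → ∀ x, he.supSeminorm (p s) x ≤ R m x := by
    intro m s hs x
    exact Finset.le_sup (f := fun s => he.supSeminorm (p s)) (Finset.mem_range.2 hs) x
  -- The number of seminorms controlled grows with `j`, so each of them is eventually covered, while
  -- those with index below `m` are covered from the start.
  let V : ℕ → Set E := fun j => closure ((R (m + j)).ball 0 ((1 / 2 : ℝ) ^ j))
  have hV : ∀ j, V j ∈ 𝓝 (0 : E) := fun j => (R (m + j)).closure_ball_mem_nhds (by positivity)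
  have hstep : ∀ j, ∀ z ∈ V j, ∃ y ∈ (R (m + j)).ball 0 ((1 / 2 : ℝ) ^ j), z - y ∈ V (j + 1) := by
    intro j z hz
    have hnear : ∀ᶠ y in 𝓝 z, z - y ∈ V (j + 1) := by
      have : Tendsto (fun y => z - y) (𝓝 z) (𝓝 0) := by
        simpa using (tendsto_const_nhds (x := z)).sub (tendsto_id (x := 𝓝 z))
      exact this (hV (j + 1))
    obtain ⟨y, hy1, hy2⟩ := mem_closure_iff_nhds.1 hz _ hnear
    exact ⟨y, hy2, hy1⟩
  choose! g hgball hgV using hstep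
  let z : ℕ → E := fun i => Nat.rec x (fun j w => w - g j w) i
  have hz0 : z 0 = x := rfl
  have hzs : ∀ j, z (j + 1) = z j - g j (z j) := fun _ => rfl
  have hzV : ∀ j, z j ∈ V j := by
    intro j
    induction j with
    | zero => simpa [V, hz0] using hx
    | succ j ih => rw [hzs]; exact hgV j _ ih
  have hgq : ∀ s j, s < m + j → he.supSeminorm (p s) (g j (z j)) ≤ (1 / 2 : ℝ) ^ j := by
    intro s j hsj
    have := hgball j _ (hzV j)
    rw [Seminorm.mem_ball_zero] at this
    exact (hRs _ s hsj _).trans this.le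
  -- The right-hand side is the exact geometric sum of `2⁻ˡ` over `i ≤ l < i + n`.
  have hgeo : ∀ s i n, s < m + i → he.supSeminorm (p s) (z i - z (i + n)) ≤
      2 * (1 / 2 : ℝ) ^ i - 2 * (1 / 2) ^ (i + n) := by
    intro s i n hsi
    induction n with
    | zero => simp
    | succ n ih =>
      have h1 : z i - z (i + (n + 1)) = (z i - z (i + n)) + g (i + n) (z (i + n)) := by
        rw [← add_assoc, hzs]; abel
      rw [h1]
      have h2 := map_add_le_add (he.supSeminorm (p s)) (z i - z (i + n)) (g (i + n) (z (i + n)))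
      have h3 := hgq s (i + n) (by omega)
      have h4 : (1 / 2 : ℝ) ^ (i + (n + 1)) = (1 / 2) ^ (i + n) * (1 / 2) := by
        rw [← add_assoc, pow_succ]
      rw [h4]; linarith
  have hz_lim : Tendsto z atTop (𝓝 0) := by
    rw [hp.tendsto_nhds_atTop]
    intro s ε hε
    have hpow : Tendsto (fun j : ℕ => (1 / 2 : ℝ) ^ j) atTop (𝓝 0) :=
      tendsto_pow_atTop_nhds_zero_of_lt_one (by norm_num) (by norm_num)
    obtain ⟨N, hN⟩ := eventually_atTop.1 (hpow.eventually (gt_mem_nhds hε))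
    refine ⟨max N (s + 1), fun j hj => ?_⟩
    rw [sub_zero]
    refine lt_of_le_of_lt ?_ (hN j (by omega))
    -- `p s` is continuous, unlike (so far) its supremum version, so its bound on the ball survives
    -- the closure.
    have hcl : IsClosed {w | p s w ≤ (1 / 2 : ℝ) ^ j} := isClosed_le (hps s) continuous_const
    refine closure_minimal (fun w hw => ?_) hcl (hzV j)
    rw [Seminorm.mem_ball_zero] at hw
    exact (he.le_supSeminorm _ (hps s) w).trans ((hRs _ s (by omega) w).trans hw.le)
  have hcoord := fun k => he.tendsto_coord_of_cauchy hp (fun j => x - z j) x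
    (by simpa using hz_lim.const_sub x) (by
      intro s ε hε
      have hpow : Tendsto (fun j : ℕ => 2 * (1 / 2 : ℝ) ^ j) atTop (𝓝 (2 * 0)) :=
        (tendsto_pow_atTop_nhds_zero_of_lt_one (by norm_num) (by norm_num)).const_mul _
      rw [mul_zero] at hpow
      obtain ⟨N, hN⟩ := eventually_atTop.1 (hpow.eventually (gt_mem_nhds hε))
      have hsym : ∀ i j, i ≤ j → N ≤ i → s + 1 ≤ i →
          he.supSeminorm (p s) (z i - z j) ≤ ε := by
        intro i j hij hNi hsi
        obtain ⟨n, rfl⟩ := Nat.exists_eq_add_of_le hij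
        refine (hgeo s i n (by omega)).trans ?_
        have h1 := hN i hNi
        have h2 : (0 : ℝ) < (1 / 2) ^ (i + n) := by positivity
        linarith
      refine ⟨max N (s + 1), fun i hi j hj => ?_⟩
      have e1 : x - z i - (x - z j) = z j - z i := by abel
      rw [e1]
      rcases le_total i j with hij | hij
      · rw [map_sub_rev]; exact hsym i j hij (by omega) (by omega)
      · exact hsym j i hij (by omega) (by omega)) k
  refine he.supSeminorm_le _ (hps s) x fun F => ?_
  have ht : Tendsto (fun j => he.proj F (x - z j)) atTop (𝓝 (he.proj F x)) := by
    simp only [proj_apply]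
    exact tendsto_finsetSum _ fun k _ => (hcoord k).smul_const _
  refine le_of_tendsto (((hps s).tendsto _).comp ht) (Eventually.of_forall fun j => ?_)
  refine (he.proj_le_supSeminorm _ (hps s) F _).trans ?_
  have h1 := hgeo s 0 j (by omega)
  rw [hz0, zero_add] at h1
  refine h1.trans ?_
  have h2 : (0 : ℝ) < (1 / 2) ^ j := by positivity
  norm_num at h2 ⊢

theorem continuous_supSeminorm (hp : WithSeminorms p) (s : ℕ) :
    Continuous (he.supSeminorm (p s)) := by
  have := hp.baireSpace
  refine Seminorm.continuous' (r := 2) ?_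
  filter_upwards [((Finset.range (s + 1)).sup fun s => he.supSeminorm (p s)).closure_ball_mem_nhds
    one_pos] with x hx
  rw [Seminorm.mem_closedBall_zero]
  exact he.le_two_of_mem_closure_ball hp (s + 1) x hx s (Nat.lt_succ_self s)

theorem continuous_coord (hp : WithSeminorms p) (k : ℕ) : Continuous (he.coord k) := by
  obtain ⟨s, hs⟩ := hp.separating_of_T1 (e k) (he.ne_zero k)
  have hs' : 0 < p s (e k) := lt_of_le_of_ne (apply_nonneg _ _) (Ne.symm hs)
  refine continuous_iff_continuousAt.2 fun x => ?_
  rw [ContinuousAt, tendsto_iff_norm_sub_tendsto_zero]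
  have hlim : Tendsto (fun y => he.supSeminorm (p s) (y - x) / p s (e k)) (𝓝 x) (𝓝 0) := by
    have : Continuous fun y => he.supSeminorm (p s) (y - x) / p s (e k) :=
      ((he.continuous_supSeminorm hp s).comp (continuous_id.sub continuous_const)).div_const _
    simpa using this.tendsto x
  refine squeeze_zero (fun _ => norm_nonneg _) (fun y => ?_) hlim
  rw [le_div_iff₀ hs', ← he.coord_sub]
  exact he.abs_coord_mul_le (p s) (hp.continuous_seminorm s) k (y - x)

/-- The coordinate as a continuous linear functional. -/
def coordL (hp : WithSeminorms p) (k : ℕ) : E →L[ℝ] ℝ := ⟨he.coordₗ k, he.continuous_coord hp k⟩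

@[simp] theorem coordL_apply (hp : WithSeminorms p) (k : ℕ) (x : E) :
    he.coordL hp k x = he.coord k x := rfl

end IsUnconditionalBasis

/-! ### Integrability expressed through seminorms -/

section Integrability

variable {E : Type*} [AddCommGroup E] [Module ℝ E] [UniformSpace E] [IsUniformAddGroup E]
  [ContinuousSMul ℝ E] {p : SeminormFamily ℝ E ℕ}
  {M : Type*} [MeasurableSpace M] {μ : Measure M}

theorem WithSeminorms.pseudoMetrizableSpace (hp : WithSeminorms p) :
    TopologicalSpace.PseudoMetrizableSpace E :=
  have := hp.isCountablyGenerated_uniformity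
  inferInstance

/-- A continuous seminorm is bounded by a multiple of a finite sum of the defining seminorms. -/
theorem WithSeminorms.exists_le_mul_sum (hp : WithSeminorms p) (q : Seminorm ℝ E)
    (hq : Continuous q) : ∃ (S : Finset ℕ) (C : ℝ), 0 ≤ C ∧ ∀ x, q x ≤ C * ∑ s ∈ S, p s x := by
  obtain ⟨S, C, -, h⟩ := Seminorm.bound_of_continuous hp q hq
  refine ⟨S, C, C.2, fun x => (h x).trans ?_⟩
  change (C : ℝ) * _ ≤ _
  refine mul_le_mul_of_nonneg_left ?_ C.2
  refine Seminorm.finset_sup_apply_le (Finset.sum_nonneg fun _ _ => apply_nonneg _ _) fun s hs => ?_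
  exact Finset.single_le_sum (f := fun s => p s x) (fun _ _ => apply_nonneg _ _) hs

/-- A strongly measurable function with integrable seminorm is approximated in mean by simple
functions. -/
theorem MeasureTheory.StronglyMeasurable.exists_simpleFunc_lintegral_seminorm_lt
    [IsFiniteMeasure μ] {g : M → E} (hg : StronglyMeasurable g) (q : Seminorm ℝ E)
    (hq : Continuous q) (hint : Integrable (fun x => q (g x)) μ) {δ : ENNReal} (hδ : 0 < δ) :
    ∃ φ : SimpleFunc M E, ∫⁻ x, ENNReal.ofReal (q (g x - φ x)) ∂μ < δ := by
  have hqg : Measurable fun x => q (g x) := (hq.comp_stronglyMeasurable hg).measurable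
  have hA : ∀ n, MeasurableSet {x | q (hg.approx n x) ≤ q (g x) + 1} := fun n =>
    measurableSet_le ((hg.approx n).map q).stronglyMeasurable
      (hqg.add_const 1).stronglyMeasurable
  -- The approximants are cut to zero where they exceed `q (g x) + 1`. This supplies the dominating
  -- function, and at each point it has no effect for large `n`.
  let φ : ℕ → SimpleFunc M E := fun n => SimpleFunc.piecewise _ (hA n) (hg.approx n) 0
  have hφ : ∀ n x, φ n x = if q (hg.approx n x) ≤ q (g x) + 1 then hg.approx n x else 0 := by
    intro n x
    simp only [φ, SimpleFunc.coe_piecewise, Set.piecewise, mem_ofPred_eq]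
    congr
  have hlim : Tendsto (fun n => ∫⁻ x, ENNReal.ofReal (q (g x - φ n x)) ∂μ) atTop
      (𝓝 (∫⁻ _, 0 ∂μ)) := by
    refine tendsto_lintegral_of_dominated_convergence
      (fun x => ENNReal.ofReal (2 * q (g x) + 1)) (fun n => ?_) (fun n => ?_) ?_ ?_
    · have : StronglyMeasurable fun x => q (g x - φ n x) :=
        hq.comp_stronglyMeasurable (hg.sub (φ n).stronglyMeasurable)
      exact this.measurable.ennreal_ofReal
    · refine Eventually.of_forall fun x => ENNReal.ofReal_le_ofReal ?_
      rw [hφ]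
      have h0 := apply_nonneg q (g x)
      split_ifs with h
      · have := map_sub_le_add q (g x) (hg.approx n x)
        linarith
      · rw [sub_zero]; linarith
    · exact ((hint.const_mul 2).add (integrable_const 1)).lintegral_lt_top.ne
    · refine Eventually.of_forall fun x => ?_
      have h1 := hg.tendsto_approx x
      have h2 := (hq.tendsto _).comp h1
      have h3 : Tendsto (fun n => ENNReal.ofReal (q (g x - hg.approx n x))) atTop (𝓝 0) := by
        have := (hq.tendsto _).comp (h1.const_sub (g x))
        rw [sub_self, map_zero] at this
        simpa using ENNReal.tendsto_ofReal this
      refine h3.congr' ?_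
      filter_upwards [h2.eventually (gt_mem_nhds (lt_add_one (q (g x))))] with n hn
      rw [hφ, if_pos (show q (hg.approx n x) ≤ q (g x) + 1 from le_of_lt hn)]
  rw [lintegral_zero] at hlim
  obtain ⟨n, hn⟩ := (hlim.eventually (gt_mem_nhds hδ)).exists
  exact ⟨φ n, hn⟩

theorem measurable_seminorm_simpleFunc (q : Seminorm ℝ E) (φ : SimpleFunc M E) :
    Measurable fun x => q (φ x) := (φ.map q).measurable

theorem IsApproximating.aestronglyMeasurable (hp : WithSeminorms p) {g : M → E}
    {φ : ℕ → SimpleFunc M E} (h : IsApproximating p μ g φ) : AEStronglyMeasurable g μ :=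
  have := hp.pseudoMetrizableSpace
  aestronglyMeasurable_of_tendsto_ae atTop (fun n => (φ n).aestronglyMeasurable) h.ae_tendsto

/-- Fatou's lemma in the first index of the Cauchy condition. -/
theorem IsApproximating.exists_lintegral_seminorm_sub_le (hp : WithSeminorms p) {g : M → E}
    {φ : ℕ → SimpleFunc M E} (h : IsApproximating p μ g φ) (s : ℕ) {ε : ℝ} (hε : 0 < ε) :
    ∃ l, ∀ m > l, ∫⁻ x, ENNReal.ofReal (p s (g x - φ m x)) ∂μ ≤ ENNReal.ofReal ε := by
  obtain ⟨l, hl⟩ := h.cauchy s ε hε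
  refine ⟨l, fun m hm => ?_⟩
  have hfatou := lintegral_liminf_le (μ := μ) (u := atTop)
    (f := fun i x => ENNReal.ofReal (p s (φ i x - φ m x)))
    (fun i => (measurable_seminorm_simpleFunc (p s) (φ i - φ m)).ennreal_ofReal)
  refine le_trans (le_of_eq (lintegral_congr_ae ?_)) (hfatou.trans ?_)
  · filter_upwards [h.ae_tendsto] with x hx
    refine (Tendsto.liminf_eq (ENNReal.tendsto_ofReal ?_)).symm
    exact ((hp.continuous_seminorm s).tendsto _).comp (hx.sub_const _)
  · refine liminf_le_of_frequently_le' (Eventually.frequently ?_)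
    filter_upwards [eventually_gt_atTop l] with i hi
    exact (hl i m hi hm).le

variable [IsFiniteMeasure μ]

theorem SimpleFunc.integrable_seminorm (q : Seminorm ℝ E) (φ : SimpleFunc M E) :
    Integrable (fun x => q (φ x)) μ :=
  SimpleFunc.integrable_of_isFiniteMeasure (φ.map q)

theorem IsApproximating.integrable_seminorm (hp : WithSeminorms p) {g : M → E}
    {φ : ℕ → SimpleFunc M E} (h : IsApproximating p μ g φ) (s : ℕ) :
    Integrable (fun x => p s (g x)) μ := by
  have hm := h.aestronglyMeasurable hp
  obtain ⟨l, hl⟩ := h.exists_lintegral_seminorm_sub_le hp s one_pos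
  have h1 : Integrable (fun x => p s (g x - φ (l + 1) x)) μ := by
    refine ⟨(hp.continuous_seminorm s).comp_aestronglyMeasurable
      (hm.sub (φ (l + 1)).aestronglyMeasurable), ?_⟩
    rw [hasFiniteIntegral_iff_ofReal (Eventually.of_forall fun x => apply_nonneg _ _)]
    exact (hl (l + 1) (Nat.lt_succ_self l)).trans_lt ENNReal.ofReal_lt_top
  refine (h1.add (SimpleFunc.integrable_seminorm (p s) (φ (l + 1)))).mono'
    ((hp.continuous_seminorm s).comp_aestronglyMeasurable hm) (Eventually.of_forall fun x => ?_)
  rw [Real.norm_of_nonneg (apply_nonneg _ _)]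
  have := map_add_le_add (p s) (g x - φ (l + 1) x) (φ (l + 1) x)
  rwa [sub_add_cancel] at this

theorem integrable_seminorm_of_forall (hp : WithSeminorms p) {g : M → E}
    (hm : AEStronglyMeasurable g μ) (h : ∀ s, Integrable (fun x => p s (g x)) μ)
    (q : Seminorm ℝ E) (hq : Continuous q) : Integrable (fun x => q (g x)) μ := by
  obtain ⟨S, C, _, hC⟩ := hp.exists_le_mul_sum q hq
  refine ((integrable_finsetSum S fun s _ => h s).const_mul C).mono'
    (hq.comp_aestronglyMeasurable hm) (Eventually.of_forall fun x => ?_)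
  rw [Real.norm_of_nonneg (apply_nonneg _ _)]
  exact hC _

/-- A diagonal choice: `φ n` is within `2⁻ⁿ` of `g` in mean for the maximum of the first `n + 1`
seminorms, so one sequence serves all of them. -/
theorem frechetIntegrable_of_integrable_seminorm (hp : WithSeminorms p) {g : M → E}
    (hm : AEStronglyMeasurable g μ) (h : ∀ s, Integrable (fun x => p s (g x)) μ) :
    FrechetIntegrable p μ g := by
  obtain ⟨g', hg', hgg'⟩ := hm
  let q : ℕ → Seminorm ℝ E := fun n => (Finset.range (n + 1)).sup p
  have hqc : ∀ n, Continuous (q n) := fun n => by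
    refine Seminorm.continuous_of_le (q := ∑ s ∈ Finset.range (n + 1), p s) ?_
      (Seminorm.finset_sup_le_sum p _)
    have hco : ((∑ s ∈ Finset.range (n + 1), p s : Seminorm ℝ E) : E → ℝ) =
        fun x => ∑ s ∈ Finset.range (n + 1), p s x := by
      ext x
      have : ∀ S : Finset ℕ, (∑ s ∈ S, p s : Seminorm ℝ E) x = ∑ s ∈ S, p s x := by
        intro S
        classical
        induction S using Finset.induction_on with
        | empty => simp
        | insert a s ha ih => rw [Finset.sum_insert ha, Finset.sum_insert ha, add_apply, ih]
      exact this _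
    rw [hco]
    exact continuous_finsetSum _ fun s _ => hp.continuous_seminorm s
  have hps : ∀ s n, s ≤ n → ∀ x, p s x ≤ q n x := fun s n hsn x =>
    Finset.le_sup (f := p) (Finset.mem_range.2 (Nat.lt_succ_of_le hsn)) x
  have hint : ∀ n, Integrable (fun x => q n (g' x)) μ := fun n =>
    integrable_seminorm_of_forall hp hg'.aestronglyMeasurable
      (fun s => (h s).congr (hgg'.mono fun x hx => by simp only [hx])) (q n) (hqc n)
  have hpow : ∀ n : ℕ, (0 : ENNReal) < ENNReal.ofReal ((1 / 2 : ℝ) ^ n) := fun n =>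
    ENNReal.ofReal_pos.2 (by positivity)
  choose φ hφ using fun n =>
    hg'.exists_simpleFunc_lintegral_seminorm_lt (q n) (hqc n) (hint n) (hpow n)
  have hmeas : ∀ n (r : Seminorm ℝ E), Continuous r →
      Measurable fun x => ENNReal.ofReal (r (g' x - φ n x)) := fun n r hr =>
    (hr.comp_stronglyMeasurable (hg'.sub (φ n).stronglyMeasurable)).measurable.ennreal_ofReal
  refine ⟨φ, fun n => measure_lt_top _ _, fun s ε hε => ?_, ?_⟩
  · have hlim : Tendsto (fun n : ℕ => (1 / 2 : ℝ) ^ n) atTop (𝓝 0) :=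
      tendsto_pow_atTop_nhds_zero_of_lt_one (by norm_num) (by norm_num)
    obtain ⟨N, hN⟩ := eventually_atTop.1 (hlim.eventually (gt_mem_nhds (half_pos hε)))
    have hle : ∀ i, max N s < i → ∫⁻ x, ENNReal.ofReal (p s (g' x - φ i x)) ∂μ <
        ENNReal.ofReal (ε / 2) := by
      intro i hi
      refine lt_of_le_of_lt (lintegral_mono fun x => ENNReal.ofReal_le_ofReal
        (hps s i (by omega) _)) ((hφ i).trans_le (ENNReal.ofReal_le_ofReal (hN i (by omega)).le))
    refine ⟨max N s, fun i m hi hm => ?_⟩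
    have hsum := ENNReal.add_lt_add (hle i hi) (hle m hm)
    rw [← ENNReal.ofReal_add (half_pos hε).le (half_pos hε).le, add_halves,
      ← lintegral_add_left (hmeas i (p s) (hp.continuous_seminorm s))] at hsum
    refine lt_of_le_of_lt (lintegral_mono fun x => ?_) hsum
    rw [← ENNReal.ofReal_add (apply_nonneg _ _) (apply_nonneg _ _)]
    refine ENNReal.ofReal_le_ofReal ?_
    have h1 : φ i x - φ m x = (g' x - φ m x) - (g' x - φ i x) := by abel
    rw [h1, add_comm]
    exact map_sub_le_add (p s) _ _
  -- Summability of the mean errors makes the pointwise errors summable, hence null, almost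
  -- everywhere; no subsequence is needed.
  · have hsum : ∫⁻ x, ∑' n, ENNReal.ofReal (q n (g' x - φ n x)) ∂μ ≠ ⊤ := by
      rw [lintegral_tsum fun n => (hmeas n (q n) (hqc n)).aemeasurable]
      refine ne_top_of_le_ne_top ?_ (ENNReal.tsum_le_tsum fun n => (hφ n).le)
      rw [← ENNReal.ofReal_tsum_of_nonneg (fun n => by positivity) summable_geometric_two]
      exact ENNReal.ofReal_ne_top
    have hfin := ae_lt_top' (AEMeasurable.tsum fun n =>
      (hmeas n (q n) (hqc n)).aemeasurable) hsum
    filter_upwards [hfin, hgg'] with x hx hgx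
    have h0 := ENNReal.tendsto_atTop_zero_of_tsum_ne_top hx.ne
    have h1 : Tendsto (fun n => q n (g' x - φ n x)) atTop (𝓝 0) := by
      have := (ENNReal.tendsto_toReal ENNReal.zero_ne_top).comp h0
      simpa [Function.comp_def, ENNReal.toReal_ofReal (apply_nonneg _ _)] using this
    rw [hp.tendsto_nhds]
    intro s ε hε
    filter_upwards [h1.eventually (gt_mem_nhds hε), eventually_ge_atTop s] with n hn hsn
    rw [hgx, map_sub_rev]
    exact (hps s n hsn _).trans_lt hn

theorem frechetIntegrable_iff (hp : WithSeminorms p) {g : M → E} :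
    FrechetIntegrable p μ g ↔
      AEStronglyMeasurable g μ ∧ ∀ s, Integrable (fun x => p s (g x)) μ :=
  ⟨fun ⟨_, h⟩ => ⟨h.aestronglyMeasurable hp, h.integrable_seminorm hp⟩,
    fun h => frechetIntegrable_of_integrable_seminorm hp h.1 h.2⟩

theorem FrechetIntegrable.integrable_seminorm (hp : WithSeminorms p) {g : M → E}
    (h : FrechetIntegrable p μ g) (q : Seminorm ℝ E) (hq : Continuous q) :
    Integrable (fun x => q (g x)) μ :=
  integrable_seminorm_of_forall hp ((frechetIntegrable_iff hp).1 h).1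
    ((frechetIntegrable_iff hp).1 h).2 q hq

theorem FrechetIntegrable.sub (hp : WithSeminorms p) {g g' : M → E}
    (h : FrechetIntegrable p μ g) (h' : FrechetIntegrable p μ g') :
    FrechetIntegrable p μ (fun x => g x - g' x) := by
  rw [frechetIntegrable_iff hp] at *
  refine ⟨h.1.sub h'.1, fun s => ((h.2 s).add (h'.2 s)).mono'
    ((hp.continuous_seminorm s).comp_aestronglyMeasurable (h.1.sub h'.1))
    (Eventually.of_forall fun x => ?_)⟩
  rw [Real.norm_of_nonneg (apply_nonneg _ _)]
  exact map_sub_le_add (p s) _ _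

theorem frechetIntegrable_const (hp : WithSeminorms p) (c : E) :
    FrechetIntegrable p μ (fun _ => c) :=
  (frechetIntegrable_iff hp).2 ⟨aestronglyMeasurable_const, fun _ => integrable_const _⟩

/-- Convergence in mean of an approximating sequence, for each continuous seminorm. -/
theorem IsApproximating.tendsto_integral_seminorm_sub (hp : WithSeminorms p) {g : M → E}
    {φ : ℕ → SimpleFunc M E} (h : IsApproximating p μ g φ) (q : Seminorm ℝ E)
    (hq : Continuous q) : Tendsto (fun n => ∫ x, q (g x - φ n x) ∂μ) atTop (𝓝 0) := by
  have hsub : ∀ n, FrechetIntegrable p μ (fun x => g x - φ n x) := fun n =>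
    FrechetIntegrable.sub hp ⟨φ, h⟩ ((frechetIntegrable_iff hp).2
      ⟨(φ n).aestronglyMeasurable, fun s => SimpleFunc.integrable_seminorm (p s) (φ n)⟩)
  have hs : ∀ s, Tendsto (fun n => ∫ x, p s (g x - φ n x) ∂μ) atTop (𝓝 0) := by
    intro s
    rw [Metric.tendsto_atTop]
    intro ε hε
    obtain ⟨l, hl⟩ := h.exists_lintegral_seminorm_sub_le hp s (half_pos hε)
    refine ⟨l + 1, fun n hn => ?_⟩
    have hnn : 0 ≤ ∫ x, p s (g x - φ n x) ∂μ := integral_nonneg fun x => apply_nonneg _ _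
    rw [Real.dist_eq, sub_zero, abs_of_nonneg hnn]
    refine lt_of_le_of_lt ?_ (half_lt_self hε)
    rw [integral_eq_lintegral_of_nonneg_ae (Eventually.of_forall fun x => apply_nonneg _ _)
      ((hsub n).integrable_seminorm hp _ (hp.continuous_seminorm s)).1]
    exact ENNReal.toReal_le_of_le_ofReal (half_pos hε).le (hl n hn)
  obtain ⟨S, C, _, hC⟩ := hp.exists_le_mul_sum q hq
  have hlim : Tendsto (fun n => C * ∑ s ∈ S, ∫ x, p s (g x - φ n x) ∂μ) atTop (𝓝 0) := by
    simpa using (tendsto_finsetSum S fun s _ => hs s).const_mul C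
  refine squeeze_zero (fun n => integral_nonneg fun x => apply_nonneg _ _) (fun n => ?_) hlim
  have hi : ∀ s, Integrable (fun x => p s (g x - φ n x)) μ := fun s =>
    (hsub n).integrable_seminorm hp _ (hp.continuous_seminorm s)
  rw [← integral_finsetSum _ fun s _ => hi s, ← integral_const_mul]
  exact integral_mono ((hsub n).integrable_seminorm hp q hq)
    ((integrable_finsetSum S fun s _ => hi s).const_mul C) fun x => hC _

theorem SimpleFunc.integral_comp_eq_sum {F : Type*} (φ : SimpleFunc M F) (G : F → ℝ) :
    ∫ x, G (φ x) ∂μ = ∑ a ∈ φ.range, μ.real (φ ⁻¹' {a}) * G a := by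
  classical
  have hrep : ∀ x, G (φ x) = ∑ a ∈ φ.range, (φ ⁻¹' {a}).indicator (fun _ => G a) x := by
    intro x
    rw [Finset.sum_eq_single (φ x)]
    · simp
    · intro a _ ha
      exact indicator_of_notMem (fun h => ha h.symm) _
    · intro h
      exact absurd (φ.mem_range_self x) h
  simp only [hrep]
  rw [integral_finsetSum _ fun a _ =>
    (integrable_const _).indicator (φ.measurableSet_fiber a)]
  refine Finset.sum_congr rfl fun a _ => ?_
  rw [integral_indicator_const _ (φ.measurableSet_fiber a), smul_eq_mul]

theorem seminorm_stepIntegral_le (q : Seminorm ℝ E) (φ : SimpleFunc M E) :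
    q (stepIntegral μ φ) ≤ ∫ x, q (φ x) ∂μ := by
  rw [SimpleFunc.integral_comp_eq_sum, stepIntegral]
  refine (Finset.le_sum_of_subadditive q (map_zero q).le (map_add_le_add q) _ _).trans ?_
  refine Finset.sum_le_sum fun a _ => ?_
  rw [map_smul_eq_mul, Real.norm_of_nonneg measureReal_nonneg]

theorem map_stepIntegral (l : E →ₗ[ℝ] ℝ) (φ : SimpleFunc M E) :
    l (stepIntegral μ φ) = ∫ x, l (φ x) ∂μ := by
  rw [SimpleFunc.integral_comp_eq_sum, stepIntegral, map_sum]
  simp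

theorem HasFrechetIntegral.seminorm_le (hp : WithSeminorms p) {g : M → E} {v : E}
    (h : HasFrechetIntegral p μ g v) (q : Seminorm ℝ E) (hq : Continuous q) :
    q v ≤ ∫ x, q (g x) ∂μ := by
  obtain ⟨φ, hφ, hv⟩ := h
  have hgi := FrechetIntegrable.integrable_seminorm hp ⟨φ, hφ⟩ q hq
  have hdi : ∀ n, Integrable (fun x => q (g x - φ n x)) μ := fun n =>
    (FrechetIntegrable.sub hp ⟨φ, hφ⟩ ((frechetIntegrable_iff hp).2 ⟨(φ n).aestronglyMeasurable,
      fun s => SimpleFunc.integrable_seminorm (p s) (φ n)⟩)).integrable_seminorm hp q hq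
  have hlim : Tendsto (fun n => ∫ x, q (g x) ∂μ + ∫ x, q (g x - φ n x) ∂μ) atTop
      (𝓝 (∫ x, q (g x) ∂μ + 0)) :=
    (hφ.tendsto_integral_seminorm_sub hp q hq).const_add _
  rw [add_zero] at hlim
  refine le_of_tendsto_of_tendsto' ((hq.tendsto v).comp hv) hlim fun n => ?_
  refine (seminorm_stepIntegral_le q (φ n)).trans ?_
  rw [← integral_add hgi (hdi n)]
  refine integral_mono (SimpleFunc.integrable_seminorm q (φ n)) (hgi.add (hdi n)) fun x => ?_
  have := map_sub_le_add q (g x) (g x - φ n x)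
  rwa [sub_sub_cancel] at this

theorem FrechetIntegrable.integrable_map (hp : WithSeminorms p) {g : M → E}
    (h : FrechetIntegrable p μ g) (l : E →L[ℝ] ℝ) : Integrable (fun x => l (g x)) μ := by
  refine (integrable_norm_iff (l.continuous.comp_aestronglyMeasurable
    ((frechetIntegrable_iff hp).1 h).1)).1 ?_
  exact h.integrable_seminorm hp ((normSeminorm ℝ ℝ).comp (l : E →ₗ[ℝ] ℝ))
    (continuous_norm.comp l.continuous)

/-- Applied to coordinates, this determines `v`, so the choice made in `frechetIntegral` is
immaterial. -/
theorem HasFrechetIntegral.map_eq (hp : WithSeminorms p) {g : M → E} {v : E}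
    (h : HasFrechetIntegral p μ g v) (l : E →L[ℝ] ℝ) : l v = ∫ x, l (g x) ∂μ := by
  obtain ⟨φ, hφ, hv⟩ := h
  have hgi := FrechetIntegrable.integrable_map hp ⟨φ, hφ⟩ l
  have hφi : ∀ n, Integrable (fun x => l (φ n x)) μ := fun n =>
    SimpleFunc.integrable_of_isFiniteMeasure ((φ n).map l)
  have hlim := hφ.tendsto_integral_seminorm_sub hp ((normSeminorm ℝ ℝ).comp (l : E →ₗ[ℝ] ℝ))
    (continuous_norm.comp l.continuous)
  refine tendsto_nhds_unique ((l.continuous.tendsto v).comp hv) ?_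
  rw [tendsto_iff_norm_sub_tendsto_zero]
  refine squeeze_zero (fun _ => norm_nonneg _) (fun n => ?_) hlim
  simp only [Function.comp_apply]
  have h1 : l (stepIntegral μ (φ n)) = ∫ x, l (φ n x) ∂μ := map_stepIntegral (l : E →ₗ[ℝ] ℝ) (φ n)
  rw [h1, norm_sub_rev, ← integral_sub hgi (hφi n)]
  refine (norm_integral_le_integral_norm _).trans (le_of_eq (integral_congr_ae ?_))
  refine Eventually.of_forall fun x => ?_
  simp

end Integrability

/-! ### Existence of the integral and its coordinates -/

section Integral

variable {E : Type*} [AddCommGroup E] [Module ℝ E] [UniformSpace E] [IsUniformAddGroup E]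
  [ContinuousSMul ℝ E] [CompleteSpace E] [T2Space E] {p : SeminormFamily ℝ E ℕ}
  {e : ℕ → E} {M : Type*} [MeasurableSpace M] {μ : Measure M}

theorem FrechetIntegrable.mono_measure (hp : WithSeminorms p) [IsFiniteMeasure μ]
    {ν : Measure M} (hν : ν ≤ μ) {g : M → E} (h : FrechetIntegrable p μ g) :
    FrechetIntegrable p ν g :=
  have : IsFiniteMeasure ν := isFiniteMeasure_of_le μ hν
  (frechetIntegrable_iff hp).2 ⟨((frechetIntegrable_iff hp).1 h).1.mono_measure hν,
    fun s => (((frechetIntegrable_iff hp).1 h).2 s).mono_measure hν⟩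

variable [IsFiniteMeasure μ]

/-- The defining sums run over unrelated ranges; coordinates reduce the claim to additivity of the
scalar integral. -/
theorem stepIntegral_sub (he : IsUnconditionalBasis e)
    (φ ψ : SimpleFunc M E) :
    stepIntegral μ (φ - ψ) = stepIntegral μ φ - stepIntegral μ ψ := by
  refine he.ext_coord fun k => ?_
  have h : ∀ χ : SimpleFunc M E, he.coord k (stepIntegral μ χ) = ∫ x, he.coord k (χ x) ∂μ :=
    fun χ => map_stepIntegral (he.coordₗ k) χ
  have hi : ∀ χ : SimpleFunc M E, Integrable (fun x => he.coord k (χ x)) μ := fun χ =>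
    SimpleFunc.integrable_of_isFiniteMeasure (χ.map (he.coord k))
  rw [he.coord_sub, h, h, h, ← integral_sub (hi φ) (hi ψ)]
  simp [he.coord_sub]

theorem FrechetIntegrable.hasFrechetIntegral (hp : WithSeminorms p) (he : IsUnconditionalBasis e)
    {g : M → E} (h : FrechetIntegrable p μ g) :
    HasFrechetIntegral p μ g (frechetIntegral p μ g) := by
  have hex : ∃ v, HasFrechetIntegral p μ g v := by
    obtain ⟨φ, hφ⟩ := id h
    have hcau : ∀ s, ∀ ε > 0, ∃ N, ∀ i ≥ N, ∀ j ≥ N,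
        p s (stepIntegral μ (φ i) - stepIntegral μ (φ j)) < ε := by
      intro s ε hε
      obtain ⟨N, hN⟩ := eventually_atTop.1 ((hφ.tendsto_integral_seminorm_sub hp (p s)
        (hp.continuous_seminorm s)).eventually (gt_mem_nhds (half_pos hε)))
      have hdi : ∀ n, Integrable (fun x => p s (g x - φ n x)) μ := fun n =>
        (h.sub hp ((frechetIntegrable_iff hp).2 ⟨(φ n).aestronglyMeasurable,
          fun s => SimpleFunc.integrable_seminorm (p s) (φ n)⟩)).integrable_seminorm hp _
          (hp.continuous_seminorm s)
      refine ⟨N, fun i hi j hj => ?_⟩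
      rw [← stepIntegral_sub he]
      refine (seminorm_stepIntegral_le (p s) (φ i - φ j)).trans_lt ?_
      have hle : ∫ x, p s ((φ i - φ j) x) ∂μ ≤
          ∫ x, (p s (g x - φ j x) + p s (g x - φ i x)) ∂μ := by
        refine integral_mono (SimpleFunc.integrable_seminorm (p s) (φ i - φ j))
          ((hdi j).add (hdi i)) fun x => ?_
        have h1 : (φ i - φ j) x = (g x - φ j x) - (g x - φ i x) := by
          rw [SimpleFunc.sub_apply]; abel
        rw [h1]
        exact map_sub_le_add (p s) _ _
      rw [integral_add (hdi j) (hdi i)] at hle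
      linarith [hN i hi, hN j hj]
    obtain ⟨v, hv⟩ := hp.exists_tendsto_of_cauchy _ hcau
    exact ⟨v, φ, hφ, hv⟩
  rw [frechetIntegral, dif_pos hex]
  exact hex.choose_spec

namespace IsUnconditionalBasis

variable (he : IsUnconditionalBasis e)

theorem integrable_coord (hp : WithSeminorms p) {g : M → E} (h : FrechetIntegrable p μ g)
    (k : ℕ) : Integrable (fun x => he.coord k (g x)) μ :=
  h.integrable_map hp (he.coordL hp k)

theorem coord_frechetIntegral (hp : WithSeminorms p) {g : M → E} (h : FrechetIntegrable p μ g)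
    (k : ℕ) : he.coord k (frechetIntegral p μ g) = ∫ x, he.coord k (g x) ∂μ :=
  (h.hasFrechetIntegral hp he).map_eq hp (he.coordL hp k)

theorem aestronglyMeasurable_of_coord (hp : WithSeminorms p) {g : M → E}
    (h : ∀ k, AEMeasurable (fun x => he.coord k (g x)) μ) : AEStronglyMeasurable g μ := by
  have := hp.pseudoMetrizableSpace
  refine aestronglyMeasurable_of_tendsto_ae (u := atTop)
    (f := fun n x => ∑ k ∈ Finset.range n, he.coord k (g x) • e k) (fun n => ?_)
    (Eventually.of_forall fun x => he.isExpansion_coord (g x))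
  refine Finset.aestronglyMeasurable_fun_sum _ fun k _ => ?_
  exact (h k).aestronglyMeasurable.smul_const (e k)

/-- A coordinatewise measurable function between two integrable functions is integrable. -/
theorem frechetIntegrable_of_coordLE (hp : WithSeminorms p) {a b g : M → E}
    (hg : ∀ k, AEMeasurable (fun x => he.coord k (g x)) μ)
    (ha : FrechetIntegrable p μ a) (hb : FrechetIntegrable p μ b)
    (hag : ∀ᵐ x ∂μ, he.CoordLE (a x) (g x)) (hgb : ∀ᵐ x ∂μ, he.CoordLE (g x) (b x)) :
    FrechetIntegrable p μ g := by
  have hm := he.aestronglyMeasurable_of_coord hp hg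
  refine (frechetIntegrable_iff hp).2 ⟨hm, fun s => ?_⟩
  have hps := hp.continuous_seminorm s
  refine ((ha.integrable_seminorm hp _ hps).add ((hb.sub hp ha).integrable_seminorm hp _
    (he.continuous_supSeminorm hp s))).mono' (hps.comp_aestronglyMeasurable hm) ?_
  filter_upwards [hag, hgb] with x hx1 hx2
  rw [Real.norm_of_nonneg (apply_nonneg _ _)]
  -- Write `g = a + (g - a)`; the second term is dominated by `b - a`, hence by a continuous
  -- seminorm of an integrable function.
  have h1 := map_add_le_add (p s) (a x) (g x - a x)
  rw [add_sub_cancel] at h1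
  refine h1.trans (add_le_add le_rfl ?_)
  refine he.seminorm_le_supSeminorm_of_le (p s) hps (fun k => ?_) fun k => ?_
  · rw [he.coord_sub]; linarith [hx1 k]
  · rw [he.coord_sub, he.coord_sub]; linarith [hx2 k]

end IsUnconditionalBasis

end Integral

/-! ### Measurability of `t ↦ f(t, x(t))` -/

section Superposition

/-- Countability of `ι` allows all the exceptional null sets to be discarded together. -/
theorem AEMeasurable.comp_countable {M ι γ : Type*} [MeasurableSpace M] [Countable ι]
    [MeasurableSpace ι] [MeasurableSingletonClass ι] [MeasurableSpace γ] {μ : Measure M}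
    {F : ι → M → γ} {N : M → ι} (hF : ∀ i, AEMeasurable (F i) μ) (hN : AEMeasurable N μ) :
    AEMeasurable (fun t => F (N t) t) μ := by
  refine ⟨fun t => (hF (hN.mk N t)).mk _ t, ?_, ?_⟩
  · exact (measurable_from_prod_countable_right (f := fun q : ι × M => (hF q.1).mk _ q.2)
      fun i => (hF i).measurable_mk).comp (hN.measurable_mk.prodMk measurable_id)
  · filter_upwards [hN.ae_eq_mk, ae_all_iff.2 fun i => (hF i).ae_eq_mk] with t h1 h2
    rw [← h1, h2]

namespace IsUnconditionalBasis

variable {E : Type*} [AddCommGroup E] [Module ℝ E] [UniformSpace E] [IsUniformAddGroup E]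
  [ContinuousSMul ℝ E] {p : SeminormFamily ℝ E ℕ}
  {e : ℕ → E} (he : IsUnconditionalBasis e) {M : Type*} [MeasurableSpace M] {μ : Measure M}

theorem coord_basis (j k : ℕ) : he.coord j (e k) = if j = k then 1 else 0 := by
  refine he.coord_eq (c := fun j => if j = k then 1 else 0) ?_ j
  refine tendsto_const_nhds.congr' ?_
  filter_upwards [eventually_gt_atTop k] with n hn
  simp [ite_smul, hn]

theorem coord_sum_range (j m : ℕ) (c : ℕ → ℝ) :
    he.coord j (∑ k ∈ Finset.range m, c k • e k) = if j < m then c j else 0 := by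
  have h : he.coord j (∑ k ∈ Finset.range m, c k • e k) =
      ∑ k ∈ Finset.range m, c k * he.coord j (e k) := by
    rw [← coordₗ_apply, map_sum]
    simp
  rw [h]
  simp [coord_basis]

theorem coord_add_sum_range (a : E) (j m : ℕ) (c : ℕ → ℝ) :
    he.coord j (a + ∑ k ∈ Finset.range m, c k • e k) =
      he.coord j a + if j < m then c j else 0 := by
  rw [he.coord_add, he.coord_sum_range]

/-- The approximation from below of `x` whose first `m` coordinates exceed those of `a` by
multiples of `2⁻ᵐ`, the others being those of `a`. -/
def lowerApprox (a : E) (m : ℕ) (x : E) : E :=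
  a + ∑ k ∈ Finset.range m,
    ((⌊(he.coord k x - he.coord k a) * 2 ^ m⌋₊ : ℝ) / 2 ^ m) • e k

theorem coord_lowerApprox (a x : E) (j m : ℕ) : he.coord j (he.lowerApprox a m x) =
    he.coord j a +
      if j < m then (⌊(he.coord j x - he.coord j a) * 2 ^ m⌋₊ : ℝ) / 2 ^ m else 0 :=
  he.coord_add_sum_range a j m _

variable {a x : E}

theorem coordLE_lowerApprox (m : ℕ) : he.CoordLE a (he.lowerApprox a m x) := by
  intro j
  rw [coord_lowerApprox]
  split_ifs
  · have : (0 : ℝ) ≤ (⌊(he.coord j x - he.coord j a) * 2 ^ m⌋₊ : ℝ) / 2 ^ m := by positivity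
    linarith
  · simp

theorem lowerApprox_coordLE (hax : he.CoordLE a x) (m : ℕ) : he.CoordLE (he.lowerApprox a m x) x := by
  intro j
  rw [coord_lowerApprox]
  have h0 : 0 ≤ he.coord j x - he.coord j a := sub_nonneg.2 (hax j)
  split_ifs
  · have h1 := Nat.floor_le (mul_nonneg h0 (by positivity : (0 : ℝ) ≤ 2 ^ m))
    rw [← div_le_iff₀ (by positivity)] at h1
    linarith
  · linarith

theorem lowerApprox_mono (hax : he.CoordLE a x) (m : ℕ) :
    he.CoordLE (he.lowerApprox a m x) (he.lowerApprox a (m + 1) x) := by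
  intro j
  rw [coord_lowerApprox, coord_lowerApprox]
  have h0 : 0 ≤ he.coord j x - he.coord j a := sub_nonneg.2 (hax j)
  set y := he.coord j x - he.coord j a
  refine add_le_add le_rfl ?_
  by_cases h : j < m
  · rw [if_pos h, if_pos (by omega)]
    have h1 := Nat.floor_le (mul_nonneg h0 (by positivity : (0 : ℝ) ≤ 2 ^ m))
    -- Dyadic grids are nested, so refining the grid cannot lower the rounded value.
    have h2 : 2 * ⌊y * 2 ^ m⌋₊ ≤ ⌊y * 2 ^ (m + 1)⌋₊ := by
      refine Nat.le_floor ?_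
      push_cast
      rw [pow_succ]; linarith
    have h3 : (2 * ⌊y * 2 ^ m⌋₊ : ℝ) ≤ ⌊y * 2 ^ (m + 1)⌋₊ := by exact_mod_cast h2
    calc (⌊y * 2 ^ m⌋₊ : ℝ) / 2 ^ m = 2 * ⌊y * 2 ^ m⌋₊ / (2 ^ m * 2) := by field_simp
      _ ≤ ⌊y * 2 ^ (m + 1)⌋₊ / (2 ^ m * 2) := div_le_div_of_nonneg_right h3 (by positivity)
      _ = _ := by rw [← pow_succ]
  · rw [if_neg h]; positivity

theorem tendsto_lowerApprox (hax : he.CoordLE a x) (hp : WithSeminorms p) :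
    Tendsto (fun m => he.lowerApprox a m x) atTop (𝓝 x) := by
  refine he.tendsto_of_coord hp (a := a) (b := x) (he.coordLE_lowerApprox)
    (he.lowerApprox_coordLE hax) fun j => ?_
  have h1 := (tendsto_nat_floor_mul_div_atTop (sub_nonneg.2 (hax j))).comp
    (tendsto_pow_atTop_atTop_of_one_lt (one_lt_two (α := ℝ)))
  have h2 := h1.const_add (he.coord j a)
  rw [add_sub_cancel] at h2
  refine h2.congr' ?_
  filter_upwards [eventually_gt_atTop j] with m hm
  rw [coord_lowerApprox, if_pos hm]
  rfl

/-- A left continuous right-hand side, evaluated along a coordinatewise measurable curve bounded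
below, is coordinatewise measurable. -/
theorem aemeasurable_coord_comp (hp : WithSeminorms p) {f : M → E → E} {x : M → E} {a : E}
    (hf : ∀ᵐ t ∂μ, ∀ k, he.LeftContinuous fun v => he.coord k (f t v))
    (hfm : ∀ v k, AEMeasurable (fun t => he.coord k (f t v)) μ)
    (hx : ∀ k, AEMeasurable (fun t => he.coord k (x t)) μ)
    (hax : ∀ᵐ t ∂μ, he.CoordLE a (x t)) (k : ℕ) :
    AEMeasurable (fun t => he.coord k (f t (x t))) μ := by
  refine aemeasurable_of_tendsto_metrizable_ae atTop
    (f := fun m t => he.coord k (f t (he.lowerApprox a m (x t)))) (fun m => ?_) ?_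
  -- The approximation depends on `t` only through finitely many natural numbers, so it ranges over
  -- the countable family `G`, on which `f` is measurable by assumption.
  · let G : (Fin m → ℕ) → E := fun n => a + ∑ k ∈ Finset.range m,
      ((if h : k < m then (n ⟨k, h⟩ : ℝ) else 0) / 2 ^ m) • e k
    let N : M → Fin m → ℕ := fun t j => ⌊(he.coord j (x t) - he.coord j a) * 2 ^ m⌋₊
    have hN : AEMeasurable N μ := by
      refine aemeasurable_pi_lambda _ fun j => ?_
      exact Nat.measurable_floor.comp_aemeasurable (((hx j).sub_const _).mul_const _)
    have hG : ∀ t, he.lowerApprox a m (x t) = G (N t) := by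
      intro t
      simp only [lowerApprox, G]
      congr 1
      refine Finset.sum_congr rfl fun j hj => ?_
      rw [dif_pos (Finset.mem_range.1 hj)]
    simp only [hG]
    exact AEMeasurable.comp_countable (F := fun n t => he.coord k (f t (G n)))
      (fun n => hfm (G n) k) hN
  · filter_upwards [hf, hax] with t h1 h2
    exact h1 k (x t) _ (he.tendsto_lowerApprox h2 hp) (he.lowerApprox_mono h2)

end IsUnconditionalBasis

end Superposition

/-! ### Primitives: continuity and Lebesgue differentiation -/

namespace IsUnconditionalBasis

variable {E : Type*} [AddCommGroup E] [Module ℝ E] [UniformSpace E] [IsUniformAddGroup E]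
  [ContinuousSMul ℝ E] [CompleteSpace E] [T2Space E] {p : SeminormFamily ℝ E ℕ}
  {e : ℕ → E}

section Primitive

variable {T : ℝ} {g : ℝ → E}

theorem _root_.FrechetIntegrable.restrict_Icc (hp : WithSeminorms p)
    (hg : FrechetIntegrable p (volume.restrict (Icc 0 T)) g) {t : ℝ} (ht : t ∈ Icc 0 T) :
    FrechetIntegrable p (volume.restrict (Icc 0 t)) g :=
  hg.mono_measure hp (Measure.restrict_mono (Icc_subset_Icc_right ht.2) le_rfl)

theorem intervalIntegrable_of_integrable_Icc {φ : ℝ → ℝ}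
    (hφ : Integrable φ (volume.restrict (Icc 0 T))) {a b : ℝ} (ha : a ∈ Icc 0 T)
    (hb : b ∈ Icc 0 T) : IntervalIntegrable φ volume a b := by
  rw [intervalIntegrable_iff]
  exact IntegrableOn.mono_set hφ (uIoc_subset_uIcc.trans (uIcc_subset_Icc ha hb))

theorem coord_primitive (he : IsUnconditionalBasis e) (hp : WithSeminorms p)
    (hg : FrechetIntegrable p (volume.restrict (Icc 0 T)) g) {t : ℝ} (ht : t ∈ Icc 0 T) (k : ℕ) :
    he.coord k (frechetIntegral p (volume.restrict (Icc 0 t)) g) =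
      ∫ ξ in (0 : ℝ)..t, he.coord k (g ξ) := by
  rw [he.coord_frechetIntegral hp (hg.restrict_Icc hp ht),
    intervalIntegral.integral_of_le ht.1, integral_Icc_eq_integral_Ioc]

/-- The vector on the left is the integral of `g - d` over `(a, b]`. Taking `d = 0` gives continuity
of the primitive, and `d` close to `g t` gives its derivative. -/
theorem seminorm_primitive_sub_le (he : IsUnconditionalBasis e) (hp : WithSeminorms p)
    (hg : FrechetIntegrable p (volume.restrict (Icc 0 T)) g) {a b : ℝ} (ha : a ∈ Icc 0 T)
    (hb : b ∈ Icc 0 T) (hab : a ≤ b) (q : Seminorm ℝ E) (hq : Continuous q) (d : E) :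
    q (frechetIntegral p (volume.restrict (Icc 0 b)) g -
      frechetIntegral p (volume.restrict (Icc 0 a)) g - (b - a) • d) ≤
      ∫ ξ in a..b, q (g ξ - d) := by
  have hgab : FrechetIntegrable p (volume.restrict (Ioc a b)) (fun ξ => g ξ - d) :=
    (hg.mono_measure hp (Measure.restrict_mono
      (Ioc_subset_Icc_self.trans (Icc_subset_Icc ha.1 hb.2)) le_rfl)).sub hp
      (frechetIntegrable_const hp d)
  have h0 : (0 : ℝ) ∈ Icc 0 T := ⟨le_rfl, ha.1.trans ha.2⟩
  have key : frechetIntegral p (volume.restrict (Icc 0 b)) g -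
      frechetIntegral p (volume.restrict (Icc 0 a)) g - (b - a) • d =
      frechetIntegral p (volume.restrict (Ioc a b)) (fun ξ => g ξ - d) := by
    refine he.ext_coord fun k => ?_
    have hi := he.integrable_coord hp hg k
    rw [he.coord_frechetIntegral hp hgab, ← intervalIntegral.integral_of_le hab]
    simp only [he.coord_sub, he.coord_smul, he.coord_primitive hp hg ha,
      he.coord_primitive hp hg hb]
    rw [intervalIntegral.integral_sub (intervalIntegrable_of_integrable_Icc hi ha hb)
      intervalIntegrable_const, intervalIntegral.integral_const, smul_eq_mul,
      intervalIntegral.integral_interval_sub_left (intervalIntegrable_of_integrable_Icc hi h0 hb)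
      (intervalIntegrable_of_integrable_Icc hi h0 ha)]
  rw [key, intervalIntegral.integral_of_le hab]
  exact (hgab.hasFrechetIntegral hp he).seminorm_le hp q hq

theorem seminorm_primitive_sub_le_abs (he : IsUnconditionalBasis e) (hp : WithSeminorms p)
    (hg : FrechetIntegrable p (volume.restrict (Icc 0 T)) g) {a b : ℝ} (ha : a ∈ Icc 0 T)
    (hb : b ∈ Icc 0 T) (q : Seminorm ℝ E) (hq : Continuous q) (d : E) :
    q (frechetIntegral p (volume.restrict (Icc 0 b)) g -
      frechetIntegral p (volume.restrict (Icc 0 a)) g - (b - a) • d) ≤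
      |∫ ξ in a..b, q (g ξ - d)| := by
  rcases le_total a b with hab | hab
  · exact (he.seminorm_primitive_sub_le hp hg ha hb hab q hq d).trans (le_abs_self _)
  · have h := he.seminorm_primitive_sub_le hp hg hb ha hab q hq d
    rw [intervalIntegral.integral_symm, abs_neg]
    refine le_trans (le_of_eq ?_) (h.trans (le_abs_self _))
    rw [← map_neg_eq_map q]
    congr 1
    module

theorem continuousOn_primitive (he : IsUnconditionalBasis e) (hp : WithSeminorms p)
    (hg : FrechetIntegrable p (volume.restrict (Icc 0 T)) g) :
    ContinuousOn (fun t => frechetIntegral p (volume.restrict (Icc 0 t)) g) (Icc 0 T) := by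
  intro t ht
  rw [ContinuousWithinAt, hp.tendsto_nhds]
  intro s ε hε
  have hi := hg.integrable_seminorm hp (p s) (hp.continuous_seminorm s)
  have h0 : (0 : ℝ) ∈ Icc 0 T := ⟨le_rfl, ht.1.trans ht.2⟩
  have hcont : ContinuousOn (fun r => ∫ ξ in (0 : ℝ)..r, p s (g ξ)) (Icc 0 T) := by
    have := intervalIntegral.continuousOn_primitive_interval (μ := volume) (a := 0) (b := T)
      (f := fun ξ => p s (g ξ)) (by rw [uIcc_of_le h0.2]; exact hi)
    rwa [uIcc_of_le h0.2] at this
  have hlim := Metric.tendsto_nhds.1 (hcont t ht) ε hε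
  filter_upwards [hlim, self_mem_nhdsWithin] with r hr hrI
  refine lt_of_le_of_lt ?_ hr
  have h := he.seminorm_primitive_sub_le_abs hp hg ht hrI (p s) (hp.continuous_seminorm s) 0
  simp only [smul_zero, sub_zero] at h
  rwa [Real.dist_eq, intervalIntegral.integral_interval_sub_left
    (intervalIntegrable_of_integrable_Icc hi h0 hrI)
    (intervalIntegrable_of_integrable_Icc hi h0 ht)]

/-- The Lebesgue differentiation theorem: the primitive of an integrable function is almost
everywhere differentiable. -/
theorem ae_tendsto_slope_primitive (he : IsUnconditionalBasis e) (hp : WithSeminorms p)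
    (hg : FrechetIntegrable p (volume.restrict (Icc 0 T)) g) :
    ∀ᵐ t ∂(volume.restrict (Icc 0 T)), Tendsto
      (fun h : ℝ => h⁻¹ • (frechetIntegral p (volume.restrict (Icc 0 (t + h))) g -
        frechetIntegral p (volume.restrict (Icc 0 t)) g)) (𝓝[≠] 0) (𝓝 (g t)) := by
  have := hp.pseudoMetrizableSpace
  rcases lt_or_ge T 0 with hT | hT
  · simp [Icc_eq_empty_of_lt hT]
  obtain ⟨S, ⟨c, hc, hSc⟩, hgS⟩ := ((frechetIntegrable_iff hp).1 hg).1.isSeparable_ae_range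
  have hi : ∀ s d, Integrable (fun ξ => p s (g ξ - d)) (volume.restrict (Icc 0 T)) := fun s d =>
    (hg.sub hp (frechetIntegrable_const hp d)).integrable_seminorm hp (p s)
      (hp.continuous_seminorm s)
  have h0 : (0 : ℝ) ∈ Icc 0 T := ⟨le_rfl, hT⟩
  have hT' : T ∈ Icc 0 T := ⟨hT, le_rfl⟩
  -- Only countably many pairs `(s, d)` occur, so a single null set serves for all of them.
  have hderiv : ∀ᵐ t ∂(volume.restrict (Icc 0 T)), ∀ s, ∀ d ∈ c,
      HasDerivAt (fun r => ∫ ξ in (0 : ℝ)..r, p s (g ξ - d)) (p s (g t - d)) t := by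
    rw [ae_all_iff]
    intro s
    rw [ae_ball_iff hc]
    intro d _
    rw [ae_restrict_iff' measurableSet_Icc]
    have := (intervalIntegrable_of_integrable_Icc (hi s d) h0 hT').ae_hasDerivAt_integral
    rw [uIcc_of_le hT] at this
    filter_upwards [this] with t ht htI
    exact ht htI 0 h0
  have hinterior : ∀ᵐ t ∂(volume.restrict (Icc 0 T)), t ∈ Ioo 0 T := by
    rw [← restrict_Ioo_eq_restrict_Icc]
    exact ae_restrict_mem measurableSet_Ioo
  filter_upwards [hgS, hderiv, hinterior] with t htS htd htI
  rw [hp.tendsto_nhds]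
  intro s ε hε
  have hps := hp.continuous_seminorm s
  obtain ⟨d, hd, hdε⟩ : ∃ d ∈ c, p s (g t - d) < ε / 2 := by
    have hopen : ∀ᶠ d in 𝓝 (g t), p s (g t - d) < ε / 2 := by
      have : Continuous fun d => p s (g t - d) := hps.comp (continuous_const.sub continuous_id)
      refine (this.tendsto (g t)).eventually (gt_mem_nhds ?_)
      simpa using half_pos hε
    obtain ⟨d, h1, h2⟩ := mem_closure_iff_nhds.1 (hSc htS) _ hopen
    exact ⟨d, h2, h1⟩
  have hslope := hasDerivAt_iff_tendsto_slope_zero.1 (htd s d hd)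
  have hmem : ∀ᶠ h in 𝓝[≠] (0 : ℝ), t + h ∈ Icc 0 T := by
    have : Tendsto (fun h : ℝ => t + h) (𝓝 0) (𝓝 t) := by
      simpa using (tendsto_id (x := 𝓝 (0 : ℝ))).const_add t
    exact nhdsWithin_le_nhds (this (Icc_mem_nhds htI.1 htI.2))
  have habs := hslope.abs
  rw [abs_of_nonneg (apply_nonneg (p s) _)] at habs
  have htI' := Ioo_subset_Icc_self htI
  filter_upwards [hmem, habs.eventually (gt_mem_nhds hdε), self_mem_nhdsWithin] with h hh1 hh2 hh3
  have hh3' : h ≠ 0 := hh3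
  have hle := he.seminorm_primitive_sub_le_abs hp hg htI' hh1 (p s) hps d
  rw [add_sub_cancel_left] at hle
  rw [intervalIntegral.integral_interval_sub_left
    (intervalIntegrable_of_integrable_Icc (hi s d) h0 hh1)
    (intervalIntegrable_of_integrable_Icc (hi s d) h0 htI'), smul_eq_mul, abs_mul] at hh2
  set Y := frechetIntegral p (volume.restrict (Icc 0 (t + h))) g -
    frechetIntegral p (volume.restrict (Icc 0 t)) g
  -- The first term is bounded by the mean of `p s (g - d)` between `t` and `t + h`, which tends to
  -- `p s (g t - d)`; both terms end up below `ε / 2`.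
  have key : h⁻¹ • Y - g t = h⁻¹ • (Y - h • d) - (g t - d) := by
    rw [smul_sub h⁻¹ Y, smul_smul, inv_mul_cancel₀ hh3', one_smul]; abel
  rw [key]
  refine (map_sub_le_add (p s) _ _).trans_lt ?_
  rw [map_smul_eq_mul, Real.norm_eq_abs]
  have := mul_le_mul_of_nonneg_left hle (abs_nonneg h⁻¹)
  linarith

end Primitive

end IsUnconditionalBasis

/-! ### Picard iteration and solutions -/

namespace IsUnconditionalBasis

variable {E : Type*} [AddCommGroup E] [Module ℝ E] [UniformSpace E] [IsUniformAddGroup E]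
  [ContinuousSMul ℝ E] [CompleteSpace E] [T2Space E] {p : SeminormFamily ℝ E ℕ}
  {e : ℕ → E} (he : IsUnconditionalBasis e)

/-- The right-hand side of the integral equation, `t ↦ x₀ + ∫₀ᵗ f(ξ, x(ξ)) dξ`. -/
def _root_.picardMap (p : SeminormFamily ℝ E ℕ) (f : ℝ → E → E) (x₀ : E) (x : ℝ → E) (t : ℝ) : E :=
  x₀ + frechetIntegral p (volume.restrict (Icc 0 t)) (fun ξ => f ξ (x ξ))

/-- The curves on `[0, T]` which are coordinatewise measurable and bounded below by `a`. -/
structure IsMeasurableAbove (T : ℝ) (a : E) (x : ℝ → E) : Prop where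
  aemeasurable : ∀ k, AEMeasurable (fun t => he.coord k (x t)) (volume.restrict (Icc 0 T))
  le : ∀ t ∈ Icc 0 T, he.CoordLE a (x t)

/-- The hypotheses on the right-hand side of the differential equation. -/
structure IsMonotoneField (p : SeminormFamily ℝ E ℕ) (T : ℝ) (f : ℝ → E → E) (x₀ C xs : E) :
    Prop where
  left : ∀ t ∈ Icc 0 T, ∀ k, he.LeftContinuous (fun x => he.coord k (f t x))
  int : ∀ x, FrechetIntegrable p (volume.restrict (Icc 0 T)) (fun t => f t x)
  le : ∀ t ∈ Icc 0 T, ∀ x, he.CoordLE (f t x) C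
  lower : ∀ t ∈ Icc 0 T, he.CoordLE xs (picardMap p f x₀ (fun _ => xs) t)
  mono : ∀ t ∈ Icc 0 T, ∀ x y, he.CoordLE x y → he.CoordLE (f t x) (f t y)

variable {he} {T : ℝ} {f : ℝ → E → E} {x₀ C xs : E}

namespace IsMonotoneField

/-- By monotonicity and the upper bound, the integrand lies between `f t xs` and `C`, both
integrable. -/
theorem frechetIntegrable (hf : he.IsMonotoneField p T f x₀ C xs) (hp : WithSeminorms p)
    {x : ℝ → E} (hx : he.IsMeasurableAbove T xs x) :
    FrechetIntegrable p (volume.restrict (Icc 0 T)) (fun t => f t (x t)) := by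
  have hmem : ∀ᵐ t ∂(volume.restrict (Icc (0 : ℝ) T)), t ∈ Icc 0 T :=
    ae_restrict_mem measurableSet_Icc
  refine he.frechetIntegrable_of_coordLE hp (fun k => ?_) (hf.int xs)
    (frechetIntegrable_const hp C) ?_ ?_
  · refine he.aemeasurable_coord_comp hp (a := xs) ?_ (fun v k => ?_) hx.aemeasurable ?_ k
    · filter_upwards [hmem] with t ht using hf.left t ht
    · exact (he.integrable_coord hp (hf.int v) k).1.aemeasurable
    · filter_upwards [hmem] with t ht using hx.le t ht
  · filter_upwards [hmem] with t ht using hf.mono t ht _ _ (hx.le t ht)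
  · filter_upwards [hmem] with t ht using hf.le t ht _

theorem coord_picardMap (hf : he.IsMonotoneField p T f x₀ C xs) (hp : WithSeminorms p)
    {x : ℝ → E} (hx : he.IsMeasurableAbove T xs x) {t : ℝ} (ht : t ∈ Icc 0 T) (k : ℕ) :
    he.coord k (picardMap p f x₀ x t) =
      he.coord k x₀ + ∫ ξ in Icc 0 t, he.coord k (f ξ (x ξ)) := by
  rw [picardMap, he.coord_add,
    he.coord_frechetIntegral hp ((hf.frechetIntegrable hp hx).restrict_Icc hp ht)]

theorem picardMap_mono (hf : he.IsMonotoneField p T f x₀ C xs) (hp : WithSeminorms p)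
    {x y : ℝ → E} (hx : he.IsMeasurableAbove T xs x) (hy : he.IsMeasurableAbove T xs y)
    (hxy : ∀ t ∈ Icc 0 T, he.CoordLE (x t) (y t)) {t : ℝ} (ht : t ∈ Icc 0 T) :
    he.CoordLE (picardMap p f x₀ x t) (picardMap p f x₀ y t) := by
  intro k
  rw [hf.coord_picardMap hp hx ht, hf.coord_picardMap hp hy ht]
  refine add_le_add le_rfl (setIntegral_mono_on
    (he.integrable_coord hp ((hf.frechetIntegrable hp hx).restrict_Icc hp ht) k)
    (he.integrable_coord hp ((hf.frechetIntegrable hp hy).restrict_Icc hp ht) k)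
    measurableSet_Icc fun ξ hξ => ?_)
  have hξ' : ξ ∈ Icc 0 T := Icc_subset_Icc_right ht.2 hξ
  exact hf.mono ξ hξ' _ _ (hxy ξ hξ') k

theorem isMeasurableAbove_const (a : E) : he.IsMeasurableAbove T a (fun _ => a) :=
  ⟨fun _ => aemeasurable_const, fun _ _ _ => le_rfl⟩

theorem continuousOn_picardMap (hf : he.IsMonotoneField p T f x₀ C xs) (hp : WithSeminorms p)
    {x : ℝ → E} (hx : he.IsMeasurableAbove T xs x) :
    ContinuousOn (picardMap p f x₀ x) (Icc 0 T) :=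
  continuousOn_const.add (he.continuousOn_primitive hp (hf.frechetIntegrable hp hx))

theorem isMeasurableAbove_picardMap (hf : he.IsMonotoneField p T f x₀ C xs)
    (hp : WithSeminorms p) {x : ℝ → E} (hx : he.IsMeasurableAbove T xs x) :
    he.IsMeasurableAbove T xs (picardMap p f x₀ x) where
  aemeasurable k := ((he.continuous_coord hp k).comp_continuousOn
    (hf.continuousOn_picardMap hp hx)).aemeasurable measurableSet_Icc
  le t ht k := (hf.lower t ht k).trans
    (hf.picardMap_mono hp (isMeasurableAbove_const xs) hx hx.le ht k)

theorem picardMap_le (hf : he.IsMonotoneField p T f x₀ C xs) (hp : WithSeminorms p)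
    {x : ℝ → E} (hx : he.IsMeasurableAbove T xs x) {t : ℝ} (ht : t ∈ Icc 0 T) :
    he.CoordLE (picardMap p f x₀ x t) (x₀ + t • C) := by
  intro k
  rw [hf.coord_picardMap hp hx ht, he.coord_add, he.coord_smul]
  refine add_le_add le_rfl ?_
  have h := setIntegral_mono_on (μ := volume)
    (he.integrable_coord hp ((hf.frechetIntegrable hp hx).restrict_Icc hp ht) k)
    (integrable_const (he.coord k C)) (measurableSet_Icc (a := 0) (b := t)) fun ξ hξ =>
      hf.le ξ (Icc_subset_Icc_right ht.2 hξ) (x ξ) k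
  refine h.trans (le_of_eq ?_)
  rw [setIntegral_const, Real.volume_real_Icc_of_le ht.1, sub_zero, smul_eq_mul]

/-- The Picard iterates of the constant `xs`. -/
def _root_.picardIter (p : SeminormFamily ℝ E ℕ) (f : ℝ → E → E) (x₀ xs : E) (n : ℕ) : ℝ → E :=
  (picardMap p f x₀)^[n] fun _ => xs

theorem _root_.picardIter_succ (n : ℕ) :
    picardIter p f x₀ xs (n + 1) = picardMap p f x₀ (picardIter p f x₀ xs n) :=
  Function.iterate_succ_apply' _ _ _

theorem isMeasurableAbove_picardIter (hf : he.IsMonotoneField p T f x₀ C xs)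
    (hp : WithSeminorms p) (n : ℕ) : he.IsMeasurableAbove T xs (picardIter p f x₀ xs n) := by
  induction n with
  | zero => exact isMeasurableAbove_const xs
  | succ n ih => rw [picardIter_succ]; exact hf.isMeasurableAbove_picardMap hp ih

theorem picardIter_mono (hf : he.IsMonotoneField p T f x₀ C xs) (hp : WithSeminorms p) (n : ℕ) :
    ∀ t ∈ Icc 0 T, he.CoordLE (picardIter p f x₀ xs n t) (picardIter p f x₀ xs (n + 1) t) := by
  induction n with
  | zero => exact fun t ht => hf.lower t ht
  | succ n ih =>
    intro t ht
    rw [picardIter_succ (n + 1)]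
    conv => arg 2; rw [picardIter_succ n]
    exact hf.picardMap_mono hp (hf.isMeasurableAbove_picardIter hp n)
      (hf.isMeasurableAbove_picardIter hp (n + 1)) ih ht

theorem picardIter_le (hf : he.IsMonotoneField p T f x₀ C xs) (hp : WithSeminorms p) (n : ℕ)
    {t : ℝ} (ht : t ∈ Icc 0 T) : he.CoordLE (picardIter p f x₀ xs n t) (x₀ + t • C) := by
  intro k
  -- Passing to the next iterate, which is always a value of `picardMap`, also covers `n = 0`.
  refine (hf.picardIter_mono hp n t ht k).trans ?_
  rw [picardIter_succ]
  exact hf.picardMap_le hp (hf.isMeasurableAbove_picardIter hp n) ht k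

/-- The Picard iterates converge. -/
theorem exists_tendsto_picardIter (hf : he.IsMonotoneField p T f x₀ C xs) (hp : WithSeminorms p)
    {t : ℝ} (ht : t ∈ Icc 0 T) :
    ∃ v, Tendsto (fun n => picardIter p f x₀ xs n t) atTop (𝓝 v) := by
  have hge : ∀ n, he.CoordLE xs (picardIter p f x₀ xs n t) := fun n =>
    (hf.isMeasurableAbove_picardIter hp n).le t ht
  have hconv : ∀ k, ∃ c, Tendsto (fun n => he.coord k (picardIter p f x₀ xs n t)) atTop (𝓝 c) :=
    fun k => ⟨_, tendsto_atTop_ciSup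
      (monotone_nat_of_le_succ fun n => hf.picardIter_mono hp n t ht k)
      ⟨he.coord k (x₀ + t • C), by rintro _ ⟨n, rfl⟩; exact hf.picardIter_le hp n ht k⟩⟩
  choose c hc using hconv
  obtain ⟨u, hu⟩ := he.exists_coord_eq_of_le hp (y := x₀ + t • C - xs)
    (c := fun k => c k - he.coord k xs)
    (fun k => sub_nonneg.2 (ge_of_tendsto' (hc k) fun n => hge n k))
    (fun k => by
      rw [he.coord_sub]
      exact sub_le_sub_right (le_of_tendsto' (hc k) fun n => hf.picardIter_le hp n ht k) _)
  refine ⟨u + xs, he.tendsto_of_coord hp hge (fun n => hf.picardIter_le hp n ht) fun k => ?_⟩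
  rw [he.coord_add, hu, sub_add_cancel]
  exact hc k

theorem exists_isSolution (hf : he.IsMonotoneField p T f x₀ C xs) (hp : WithSeminorms p) :
    ∃ x : ℝ → E, IsSolution p T f x₀ x := by
  -- Off `[0, T]` the limit curve takes an arbitrary value, which plays no role.
  have hex : ∀ t, ∃ v, t ∈ Icc 0 T →
      Tendsto (fun n => picardIter p f x₀ xs n t) atTop (𝓝 v) := fun t => by
    by_cases ht : t ∈ Icc 0 T
    · obtain ⟨v, hv⟩ := hf.exists_tendsto_picardIter hp ht
      exact ⟨v, fun _ => hv⟩
    · exact ⟨0, fun h => absurd h ht⟩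
  choose x hx using hex
  have hcoord : ∀ t ∈ Icc 0 T, ∀ k, Tendsto (fun n => he.coord k (picardIter p f x₀ xs n t)) atTop
      (𝓝 (he.coord k (x t))) := fun t ht k =>
    ((he.continuous_coord hp k).tendsto _).comp (hx t ht)
  have hmem : ∀ᵐ t ∂(volume.restrict (Icc (0 : ℝ) T)), t ∈ Icc 0 T :=
    ae_restrict_mem measurableSet_Icc
  have hxm : he.IsMeasurableAbove T xs x :=
    { aemeasurable := fun k => aemeasurable_of_tendsto_metrizable_ae atTop
        (fun n => (hf.isMeasurableAbove_picardIter hp n).aemeasurable k)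
        (by filter_upwards [hmem] with t ht using hcoord t ht k)
      le := fun t ht k => ge_of_tendsto' (hcoord t ht k) fun n =>
        (hf.isMeasurableAbove_picardIter hp n).le t ht k }
  have heq : ∀ t ∈ Icc 0 T, x t = picardMap p f x₀ x t := by
    intro t ht
    refine he.ext_coord fun k => ?_
    refine tendsto_nhds_unique ((hcoord t ht k).comp (tendsto_add_atTop_nat 1)) ?_
    simp only [Function.comp_def, picardIter_succ]
    simp only [hf.coord_picardMap hp hxm ht,
      hf.coord_picardMap hp (hf.isMeasurableAbove_picardIter hp _) ht]
    refine Tendsto.const_add _ ?_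
    have hmem' : ∀ᵐ ξ ∂(volume.restrict (Icc (0 : ℝ) t)), ξ ∈ Icc 0 T := by
      filter_upwards [ae_restrict_mem measurableSet_Icc] with ξ hξ
        using Icc_subset_Icc_right ht.2 hξ
    refine tendsto_integral_of_dominated_convergence
      (fun ξ => |he.coord k (f ξ xs)| + |he.coord k C|) (fun n => ?_) ?_ (fun n => ?_) ?_
    · exact (he.integrable_coord hp ((hf.frechetIntegrable hp
        (hf.isMeasurableAbove_picardIter hp n)).restrict_Icc hp ht) k).1
    · exact (he.integrable_coord hp ((hf.int xs).restrict_Icc hp ht) k).abs.add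
        (integrable_const _)
    · filter_upwards [hmem'] with ξ hξ
      have h1 := hf.mono ξ hξ _ _ ((hf.isMeasurableAbove_picardIter hp n).le ξ hξ) k
      have h2 := hf.le ξ hξ (picardIter p f x₀ xs n ξ) k
      rw [Real.norm_eq_abs, abs_le]
      constructor
      · linarith [neg_abs_le (he.coord k (f ξ xs)), abs_nonneg (he.coord k C)]
      · linarith [le_abs_self (he.coord k C), abs_nonneg (he.coord k (f ξ xs))]
    · filter_upwards [hmem'] with ξ hξ
      -- The iterates increase to `x ξ`, which is exactly the setting of left continuity.
      exact hf.left ξ hξ k _ _ (hx ξ hξ) fun n => hf.picardIter_mono hp n ξ hξ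
  -- As a pointwise limit `x` was only known to be measurable; its continuity comes from the
  -- fixed-point equation.
  exact ⟨x, (hf.continuousOn_picardMap hp hxm).congr heq, hf.frechetIntegrable hp hxm, heq⟩

end IsMonotoneField

/-- A solution is almost everywhere differentiable, hence weakly differentiable. -/
theorem _root_.IsSolution.ae_hasWeakDerivAt (he : IsUnconditionalBasis e) (hp : WithSeminorms p)
    {x : ℝ → E} (hx : IsSolution p T f x₀ x) :
    ∀ᵐ t ∂(volume.restrict (Icc 0 T)), HasWeakDerivAt x (f t (x t)) t := by
  have hinterior : ∀ᵐ t ∂(volume.restrict (Icc 0 T)), t ∈ Ioo 0 T := by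
    rw [← restrict_Ioo_eq_restrict_Icc]
    exact ae_restrict_mem measurableSet_Ioo
  filter_upwards [he.ae_tendsto_slope_primitive hp hx.integrable, hinterior] with t ht htI ψ
  refine (ψ.continuous.tendsto _).comp (ht.congr' ?_)
  have hmem : ∀ᶠ h in 𝓝[≠] (0 : ℝ), t + h ∈ Icc 0 T := by
    have : Tendsto (fun h : ℝ => t + h) (𝓝 0) (𝓝 t) := by
      simpa using (tendsto_id (x := 𝓝 (0 : ℝ))).const_add t
    exact nhdsWithin_le_nhds (this (Icc_mem_nhds htI.1 htI.2))
  filter_upwards [hmem] with h hh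
  rw [hx.integral_eq _ hh, hx.integral_eq t (Ioo_subset_Icc_self htI), add_sub_add_left_eq_sub]

end IsUnconditionalBasis

end

theorem theorem2p3
    {E : Type*} [AddCommGroup E] [Module ℝ E] [UniformSpace E] [IsUniformAddGroup E]
    [ContinuousSMul ℝ E] [CompleteSpace E] [T2Space E]
    -- `E` is a Fréchet space, its topology being given by the seminorms `p n`
    (p : SeminormFamily ℝ E ℕ) (hp : WithSeminorms p)
    (hE : IsReflexiveSpace E)
    (e : ℕ → E) (he : IsUnconditionalBasis e)
    (T : ℝ) (hT : 0 < T) (f : ℝ → E → E) (x₀ C xs : E)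
    (hf_left : ∀ t ∈ Icc 0 T, ∀ k, he.LeftContinuous (fun x => he.coord k (f t x)))
    (hf_int : ∀ x, FrechetIntegrable p (volume.restrict (Icc 0 T)) (fun t => f t x))
    (hf_le : ∀ t ∈ Icc 0 T, ∀ x, he.CoordLE (f t x) C)
    (hxs : ∀ t ∈ Icc 0 T,
      he.CoordLE xs (x₀ + frechetIntegral p (volume.restrict (Icc 0 t)) (fun ξ => f ξ xs)))
    (hf_mono : ∀ t ∈ Icc 0 T, ∀ x y, he.CoordLE x y → he.CoordLE (f t x) (f t y)) :
    (∃ x : ℝ → E, IsSolution p T f x₀ x) ∧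
    ∀ x : ℝ → E, IsSolution p T f x₀ x →
      ∃ xdot : ℝ → E, ∀ᵐ t ∂(volume.restrict (Icc 0 T)),
        HasWeakDerivAt x (xdot t) t ∧ xdot t = f t (x t) := by
  have hf : he.IsMonotoneField p T f x₀ C xs := ⟨hf_left, hf_int, hf_le, hxs, hf_mono⟩
  refine ⟨hf.exists_isSolution hp, fun x hx => ⟨fun t => f t (x t), ?_⟩⟩
  filter_upwards [hx.ae_hasWeakDerivAt he hp] with t ht using ⟨ht, rfl⟩
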